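/- For a positive semidefinite complex matrix $A$ let $s(A)$ be its support projection, i.e. the orthogonal projection onto $(\ker A)^{\perp}$; let $A^{-1}$ be its generalized inverse (the inverse on the support, zero on the kernel), and put $A^{-r}:=(A^{-1})^{r}$ for $r>0$. For $0<\alpha<1$ and $p>0$ let $$A\#_\alpha B:=A^{1/2}(A^{-1/2}BA^{-1/2})^{\alpha}A^{1/2},\qquad \widetilde F_\alpha(A,B):=(A^{-1}\#_\alpha B)^{1/2}A^{2(1-\alpha)}(A^{-1}\#_\alpha B)^{1/2},$$ $$\widetilde{SG}_{\alpha,p}(A,B):=\widetilde F_\alpha(A^p,B^p)^{1/p},\qquad R_{\alpha,p}(A,B):=\bigl(A^{\frac{1-\alpha}{2}p}B^{\alpha p}A^{\frac{1-\alpha}{2}p}\bigr)^{1/p},$$ for $n\times n$ positive semidefinite matrices $A,B$ (any $n$) with $s(A)\ge s(B)$. For $n\times n$ positive semidefinite $X,Y$ with eigenvalues $\lambda_1\ge\dots\ge\lambda_n$ in decreasing order with multiplicities, $X\prec_{\log}Y$ means that $\prod_{i=1}^k\lambda_i(X)\le\prod_{i=1}^k\lambda_i(Y)$ for $1\le k\le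 n$, with equality for $k=n$. **Theorem 3.6.** Let $0<\alpha<1$ and $p,q>0$. (1) The following conditions are equivalent: (i) $\widetilde{SG}_{\alpha,p}(A,B)\prec_{\log}R_{\alpha,q}(A,B)$ for all positive semidefinite $A,B$ (of every size) with $s(A)\ge s(B)$; (ii) $\widetilde{SG}_{\alpha,p}(A,B)\prec_{\log}R_{\alpha,q}(A,B)$ for all $2\times2$ positive definite $A,B$; (iii) $p/q\le\alpha$. (2) If $\alpha\le1/2$ and $q\le p$, then $R_{\alpha,q}(A,B)\prec_{\log}\widetilde{SG}_{\alpha,p}(A,B)$ for all positive semidefinite $A,B$ with $s(A)\ge s(B)$. (3) If $R_{\alpha,q}(A,B)\prec_{\log}\widetilde{SG}_{\alpha,p}(A,B)$ for all $2\times2$ positive definite $A,B$, then $\alpha\le1/2$ and $p/q\ge1/2$. -/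

import Mathlib

open scoped MatrixOrder ComplexOrder

noncomputable section

namespace QuasiMean

/-- The support projection `s(A)` of `A`: the orthogonal projection onto the orthogonal complement
of the kernel of `A`, acting on `ℂⁿ` with its Euclidean inner product. Such projections are
compared in the Loewner order `≤` of operators on a Hilbert space. -/
def supportProj {n : ℕ} (A : Matrix (Fin n) (Fin n) ℂ) :
    EuclideanSpace ℂ (Fin n) →L[ℂ] EuclideanSpace ℂ (Fin n) :=
  ((LinearMap.ker (Matrix.toEuclideanLin A))ᗮ).starProjection

/-- The `α`-weighted geometric mean `A #_α B = A^{1/2} (A^{-1/2} B A^{-1/2})^α A^{1/2}`, for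
positive semidefinite `A`, `B` with `s(A) ≥ s(B)`.

Throughout, `A ^ r` for a real exponent `r` is the power by functional calculus. Since
`0 ^ r = 0` for every real `r ≠ 0`, for a singular positive semidefinite `A` and `r < 0` this is
the power of the generalized inverse (the inverse of `A` on its support, zero on its kernel). -/
def geomMean {n : ℕ} (α : ℝ) (A B : Matrix (Fin n) (Fin n) ℂ) : Matrix (Fin n) (Fin n) ℂ :=
  A ^ (1 / 2 : ℝ) * (A ^ (-(1 / 2) : ℝ) * B * A ^ (-(1 / 2) : ℝ)) ^ α * A ^ (1 / 2 : ℝ)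

/-- The weighted spectral geometric mean
`F̃_α(A, B) = (A⁻¹ #_α B)^{1/2} A^{2(1-α)} (A⁻¹ #_α B)^{1/2}`, where `A⁻¹` is the generalized
inverse. -/
def spectralMean {n : ℕ} (α : ℝ) (A B : Matrix (Fin n) (Fin n) ℂ) : Matrix (Fin n) (Fin n) ℂ :=
  (geomMean α (A ^ (-1 : ℝ)) B) ^ (1 / 2 : ℝ) * A ^ (2 * (1 - α)) *
    (geomMean α (A ^ (-1 : ℝ)) B) ^ (1 / 2 : ℝ)

/-- The quasi-extension `S̃G_{α,p}(A, B) = F̃_α(A^p, B^p)^{1/p}`. -/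
def quasiSpectralMean {n : ℕ} (α p : ℝ) (A B : Matrix (Fin n) (Fin n) ℂ) :
    Matrix (Fin n) (Fin n) ℂ :=
  (spectralMean α (A ^ p) (B ^ p)) ^ (1 / p)

/-- The Rényi mean `R_{α,p}(A, B) = (A^{(1-α)p/2} B^{αp} A^{(1-α)p/2})^{1/p}`. -/
def renyiMean {n : ℕ} (α p : ℝ) (A B : Matrix (Fin n) (Fin n) ℂ) : Matrix (Fin n) (Fin n) ℂ :=
  (A ^ ((1 - α) / 2 * p) * B ^ (α * p) * A ^ ((1 - α) / 2 * p)) ^ (1 / p)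

/-- Log-majorization `X ≺_log Y` of positive semidefinite matrices: with the eigenvalues
`λ₁ ≥ λ₂ ≥ … ≥ λₙ` in decreasing order with multiplicities (`eigenvalues₀`), the product of the
`k` largest eigenvalues of `X` is at most that of `Y` for each `1 ≤ k ≤ n`, and the products of
all the eigenvalues are equal. -/
def LogMajorizedBy {n : ℕ} (X Y : Matrix (Fin n) (Fin n) ℂ) : Prop :=
  ∃ (hX : X.PosSemidef) (hY : Y.PosSemidef),
    (∀ k, ∏ i ∈ Finset.Iic k, hX.isHermitian.eigenvalues₀ i ≤
      ∏ i ∈ Finset.Iic k, hY.isHermitian.eigenvalues₀ i) ∧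
    ∏ i, hX.isHermitian.eigenvalues₀ i = ∏ i, hY.isHermitian.eigenvalues₀ i

end QuasiMean

end

/-! Compound matrices turn log-majorization into norm inequalities. Taking the `k`-th compound is
multiplicative and commutes with real powers of positive semidefinite matrices, hence with both
means, and the norm of the compound is the product of the `k` largest eigenvalues. Both determinants
have modulus `|det A|^(1-α) |det B|^α` for positive definite `A`. So `‖·‖ ≤ ‖·‖` in every dimension
suffices (`logMajorizedBy_of_norm_compound_le`), and a singular `A` is first replaced by a positive
definite matrix (`exists_posDef_means_eq`).

For `p ≤ αq`, a norm bound on the Rényi side reads `B^(αq) ≤ N A^(-(1-α)q)`. Loewner–Heinz with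
exponent `p/(αq) ≤ 1`, a conjugation, the power `α` and another conjugation bound the spectral side,
all powers of `A` cancelling. The reverse bound for `α ≤ 1/2`, `q ≤ p` needs more. With `C = A^(p/2)
B^p A^(p/2)` and `D = A^(-p)`, one must pass from `C^α ≤ c D^(1-2α)` to `(D^(1/2) C D^(1/2))^α ≤ c
D^(1-α)`. Iterating a Furuta inequality in small steps does this (`rpow_half_conj_rpow_le`).

For necessity, `B` is taken to be a rank-one projection `E`, reached as a limit of positive definite
matrices, and `A = diag(1, t)`. Then `E A^r E = m(r) E` with `m(r) = s + (1-s) t^r`, and both norms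
are explicit in `m`. Letting `t → 0` with `s = 1/2`, or with `s` a suitable power of `t`, and
comparing orders of decay gives the constraints on `α` and `p/q`. -/

section

open scoped Matrix.Norms.L2Operator

/-! ### Real powers of matrices by functional calculus on a finite spectrum. -/

namespace Matrix

variable {n : Type*} [Fintype n] [DecidableEq n]

lemma finite_nnreal_spectrum (A : Matrix n n ℂ) : (spectrum NNReal A).Finite := by
  rw [← spectrum.preimage_algebraMap ℝ]
  exact A.finite_real_spectrum.preimage NNReal.coe_injective.injOn

lemma continuousOn_nnreal_spectrum (A : Matrix n n ℂ) (f : NNReal → NNReal) :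
    ContinuousOn f (spectrum NNReal A) := A.finite_nnreal_spectrum.continuousOn f

lemma continuousOn_real_spectrum (A : Matrix n n ℂ) (f : ℝ → ℝ) :
    ContinuousOn f (spectrum ℝ A) := A.finite_real_spectrum.continuousOn f

lemma rpow_nonneg (A : Matrix n n ℂ) (r : ℝ) : 0 ≤ A ^ r := CFC.rpow_nonneg

lemma rpow_rpow {A : Matrix n n ℂ} (hA : 0 ≤ A) (x y : ℝ) : (A ^ x) ^ y = A ^ (x * y) := by
  simp only [CFC.rpow_def]
  rw [← cfc_comp (fun t : NNReal => t ^ y) (fun t : NNReal => t ^ x) A hA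
    ((A.finite_nnreal_spectrum.image _).continuousOn _) (A.continuousOn_nnreal_spectrum _)]
  exact cfc_congr fun t _ => (NNReal.rpow_mul t x y).symm

/-- The exponents may not cancel because `0 ^ 0 = 1`: on the kernel of a singular `A`, a product of
opposite nonzero powers gives 0, not 1. -/
lemma rpow_mul_rpow (A : Matrix n n ℂ) {x y : ℝ} (h : x + y ≠ 0) :
    A ^ x * A ^ y = A ^ (x + y) := by
  simp only [CFC.rpow_def]
  rw [← cfc_mul _ _ A (A.continuousOn_nnreal_spectrum _) (A.continuousOn_nnreal_spectrum _)]
  refine cfc_congr fun t _ => ?_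
  rcases eq_or_ne t 0 with rfl | ht
  · rcases eq_or_ne x 0 with rfl | hx
    · simp
    · simp [NNReal.zero_rpow hx, NNReal.zero_rpow h]
  · exact (NNReal.rpow_add ht x y).symm

lemma smul_rpow {A : Matrix n n ℂ} (hA : 0 ≤ A) {c : ℝ} (hc : 0 ≤ c) (r : ℝ) :
    (c • A) ^ r = c ^ r • A ^ r := by
  rw [CFC.rpow_eq_cfc_real (smul_nonneg hc hA), CFC.rpow_eq_cfc_real hA,
    ← cfc_smul _ _ A (A.continuousOn_real_spectrum _)]
  rw [← cfc_comp_smul c (fun t : ℝ => t ^ r) A ((A.finite_real_spectrum.image _).continuousOn _)]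
  exact cfc_congr fun t ht => Real.mul_rpow hc (spectrum_nonneg_of_nonneg hA ht)

lemma rpow_conj_nonneg (A : Matrix n n ℂ) {B : Matrix n n ℂ}
    (hB : 0 ≤ B) (r : ℝ) : 0 ≤ A ^ r * B * A ^ r :=
  conjugate_nonneg_of_nonneg hB (rpow_nonneg A r)

lemma conjStarAlgAut_rpow (U : unitaryGroup n ℂ) {A : Matrix n n ℂ} (hA : 0 ≤ A) (r : ℝ) :
    (Unitary.conjStarAlgAut ℂ _ U A) ^ r = Unitary.conjStarAlgAut ℂ _ U (A ^ r) := by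
  have h : 0 ≤ Unitary.conjStarAlgAut ℂ _ U A := map_nonneg _ hA
  rw [CFC.rpow_eq_cfc_real h, CFC.rpow_eq_cfc_real hA]
  refine (StarAlgHomClass.map_cfc (S := ℂ) (Unitary.conjStarAlgAut ℂ _ U) _ A
    (A.continuousOn_real_spectrum _) ?_ hA.isSelfAdjoint h.isSelfAdjoint).symm
  change Continuous fun B : Matrix n n ℂ => (U : Matrix n n ℂ) * B * (star U : unitaryGroup n ℂ)
  fun_prop

lemma diagonal_rpow {d : n → ℝ} (hd : ∀ i, 0 ≤ d i) (r : ℝ) :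
    (diagonal fun i => (d i : ℂ)) ^ r = diagonal fun i => ((d i ^ r : ℝ) : ℂ) := by
  have h : (0 : Matrix n n ℂ) ≤ diagonal fun i => (d i : ℂ) := by
    rw [nonneg_iff_posSemidef, posSemidef_diagonal_iff]
    simpa using hd
  -- An interpolating polynomial agrees with `x ^ r` on the spectrum, and polynomials act on
  -- diagonal matrices entrywise.
  let s : Finset ℝ := Finset.univ.image d
  let P : Polynomial ℝ := Lagrange.interpolate s id fun x => x ^ r
  have hP (i : n) : P.eval (d i) = d i ^ r :=
    Lagrange.eval_interpolate_at_node (v := id) _ Function.injective_id.injOn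
      (Finset.mem_image_of_mem d (Finset.mem_univ i))
  have hspec : Set.EqOn (fun x : ℝ => x ^ r) P.eval (spectrum ℝ (diagonal fun i => (d i : ℂ))) := by
    intro x hx
    have hx' := spectrum.algebraMap_mem ℂ hx
    rw [spectrum_diagonal] at hx'
    obtain ⟨i, hi⟩ := hx'
    obtain rfl : d i = x := by simpa using hi
    exact (hP i).symm
  rw [CFC.rpow_eq_cfc_real h, cfc_congr hspec, cfc_polynomial P _ h.isSelfAdjoint]
  have h1 : Polynomial.aeval (diagonal fun i => (d i : ℂ)) P =
      diagonalAlgHom ℝ (Polynomial.aeval (fun i => (d i : ℂ)) P) :=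
    Polynomial.aeval_algHom_apply (diagonalAlgHom ℝ) _ P
  rw [h1]
  change diagonal _ = _
  congr 1
  ext i
  have h2 : (Polynomial.aeval (fun i => (d i : ℂ)) P) i = Polynomial.aeval (d i : ℂ) P :=
    (Polynomial.aeval_algHom_apply (Pi.evalAlgHom ℝ (fun _ : n => ℂ) i) _ P).symm
  rw [h2, ← hP i]
  exact Polynomial.aeval_algebraMap_apply ℂ (d i) P

end Matrix

/-! ### The Cauchy–Binet formula and compound matrices. -/

namespace Matrix

/-- Sums over injective maps out of `Fin k` split as sums over order embeddings and
permutations. -/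
lemma sum_injective_eq_sum_orderEmbedding {M : Type*} [AddCommMonoid M] {k n : ℕ}
    (F : (Fin k → Fin n) → M) (hF : ∀ r, ¬ Function.Injective r → F r = 0) :
    ∑ r, F r = ∑ g : Fin k ↪o Fin n, ∑ σ : Equiv.Perm (Fin k), F (g ∘ σ) := by
  rw [← Finset.sum_product']
  symm
  refine Finset.sum_of_injOn (fun x : (Fin k ↪o Fin n) × Equiv.Perm (Fin k) => x.1 ∘ x.2)
    ?_ (by simp) ?_ (by simp)
  · rintro ⟨g, σ⟩ - ⟨g', σ'⟩ - h
    have h : (g : Fin k → Fin n) ∘ σ = g' ∘ σ' := h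
    have hg : g = g' := by
      have : Set.range g = Set.range g' := by
        rw [← σ.surjective.range_comp g, ← σ'.surjective.range_comp g', h]
      exact DFunLike.coe_injective ((StrictMono.range_inj g.strictMono g'.strictMono).mp this)
    subst hg
    have hσ : σ = σ' := Equiv.ext fun i => g.injective (congrFun h i)
    rw [hσ]
  · intro r _ hr
    apply hF
    intro hinj
    apply hr
    -- Sorting factors an injective tuple into an increasing one and a permutation.
    have hmono : StrictMono (r ∘ Tuple.sort r) :=
      (Tuple.monotone_sort r).strictMono_of_injective (hinj.comp (Tuple.sort r).injective)
    refine ⟨(OrderEmbedding.ofStrictMono _ hmono, (Tuple.sort r)⁻¹), by simp, ?_⟩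
    ext i
    simp

/-- The **Cauchy–Binet formula**. -/
lemma det_mul_eq_sum_orderEmbedding {R : Type*} [CommRing R] {k n : ℕ}
    (M : Matrix (Fin k) (Fin n) R) (N : Matrix (Fin n) (Fin k) R) :
    (M * N).det = ∑ g : Fin k ↪o Fin n, (M.submatrix id g).det * (N.submatrix g id).det := by
  have h1 : (M * N).det = ∑ r : Fin k → Fin n, (∏ i, M i (r i)) * (N.submatrix r id).det := by
    have : (M * N) = fun i => ∑ j, M i j • N j := by
      ext i l
      simp [mul_apply, Finset.sum_apply]
    change detRowAlternating (M * N) = _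
    rw [this, ← AlternatingMap.coe_multilinearMap, MultilinearMap.map_sum]
    refine Finset.sum_congr rfl fun r _ => ?_
    rw [MultilinearMap.map_smul_univ]
    rfl
  rw [h1, sum_injective_eq_sum_orderEmbedding]
  · refine Finset.sum_congr rfl fun g _ => ?_
    have h2 (σ : Equiv.Perm (Fin k)) :
        (N.submatrix (g ∘ σ) id).det = Equiv.Perm.sign σ * (N.submatrix g id).det := by
      rw [← det_permute σ (N.submatrix g id)]
      rfl
    simp_rw [h2]
    rw [← det_transpose (M.submatrix id g), det_apply' (M.submatrix id g)ᵀ, Finset.sum_mul]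
    refine Finset.sum_congr rfl fun σ _ => ?_
    simp only [Function.comp_apply, transpose_apply, submatrix_apply, id]
    ring
  · intro r hr
    obtain ⟨i, j, hij, hne⟩ : ∃ i j, r i = r j ∧ i ≠ j := by
      simpa [Function.Injective] using hr
    rw [det_zero_of_row_eq hne, mul_zero]
    ext l
    simp [hij]

/-- The `k`-th compound of a matrix, the matrix of its minors of order `k`, with the increasing
`k`-tuples of indices enumerated in some order. -/
noncomputable def compound {n : ℕ} (k : ℕ) (A : Matrix (Fin n) (Fin n) ℂ) :
    Matrix (Fin (Fintype.card (Fin k ↪o Fin n))) (Fin (Fintype.card (Fin k ↪o Fin n))) ℂ :=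
  of fun i j => (A.submatrix ((Fintype.equivFin (Fin k ↪o Fin n)).symm i)
    ((Fintype.equivFin (Fin k ↪o Fin n)).symm j)).det

variable {n k : ℕ}

lemma compound_mul (A B : Matrix (Fin n) (Fin n) ℂ) :
    compound k (A * B) = compound k A * compound k B := by
  ext i j
  have h := det_mul_eq_sum_orderEmbedding
    (A.submatrix ((Fintype.equivFin (Fin k ↪o Fin n)).symm i) id)
    (B.submatrix id ((Fintype.equivFin (Fin k ↪o Fin n)).symm j))
  rw [← submatrix_mul _ _ _ _ _ Function.bijective_id] at h
  rw [mul_apply]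
  refine h.trans ?_
  exact ((Fintype.equivFin (Fin k ↪o Fin n)).symm.sum_comp fun g =>
    ((A.submatrix ((Fintype.equivFin (Fin k ↪o Fin n)).symm i) g).det *
      (B.submatrix g ((Fintype.equivFin (Fin k ↪o Fin n)).symm j)).det)).symm

lemma compound_diagonal (d : Fin n → ℂ) :
    compound k (diagonal d) = diagonal fun i =>
      ∏ l, d ((Fintype.equivFin (Fin k ↪o Fin n)).symm i l) := by
  ext i j
  simp only [compound, of_apply]
  rcases eq_or_ne i j with rfl | hij
  · rw [submatrix_diagonal _ _ (RelEmbedding.injective _), det_diagonal, diagonal_apply_eq]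
    rfl
  · rw [diagonal_apply_ne _ hij]
    set f := (Fintype.equivFin (Fin k ↪o Fin n)).symm i
    set g := (Fintype.equivFin (Fin k ↪o Fin n)).symm j
    have hfg : f ≠ g := fun h => hij ((Fintype.equivFin _).symm.injective h)
    -- Distinct increasing tuples of equal length have different ranges, so some row of the minor is
    -- zero.
    obtain ⟨l, hl⟩ : ∃ l, f l ∉ Set.range g := by
      by_contra! h
      have hsub : Set.range f ⊆ Set.range g := by
        rintro _ ⟨l, rfl⟩
        exact h l
      have hcard : (Set.range g).ncard ≤ (Set.range f).ncard := by
        rw [Set.ncard_range_of_injective g.injective, Set.ncard_range_of_injective f.injective]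
      exact hfg (DFunLike.coe_injective ((StrictMono.range_inj f.strictMono g.strictMono).mp
        (Set.eq_of_subset_of_ncard_le hsub hcard (Set.toFinite _))))
    refine det_eq_zero_of_row_eq_zero l fun m => ?_
    exact diagonal_apply_ne _ fun h => hl ⟨m, h.symm⟩

lemma compound_one : compound k (1 : Matrix (Fin n) (Fin n) ℂ) = 1 := by
  rw [← diagonal_one, compound_diagonal]
  simp

lemma compound_conjTranspose (A : Matrix (Fin n) (Fin n) ℂ) :
    compound k Aᴴ = (compound k A)ᴴ := by
  ext i j
  simp only [compound, of_apply, conjTranspose_apply]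
  rw [← det_conjTranspose, conjTranspose_submatrix]

lemma compound_mem_unitaryGroup {U : Matrix (Fin n) (Fin n) ℂ}
    (hU : U ∈ unitaryGroup (Fin n) ℂ) : compound k U ∈ unitaryGroup _ ℂ := by
  rw [mem_unitaryGroup_iff, star_eq_conjTranspose, ← compound_conjTranspose, ← compound_mul,
    ← star_eq_conjTranspose, mem_unitaryGroup_iff.mp hU, compound_one]

/-- The compound of a unitary matrix, as a unitary matrix. -/
noncomputable def compoundUnitary (k : ℕ) (U : unitaryGroup (Fin n) ℂ) :
    unitaryGroup (Fin (Fintype.card (Fin k ↪o Fin n))) ℂ :=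
  ⟨compound k U, compound_mem_unitaryGroup U.2⟩

lemma compound_conjStarAlgAut (U : unitaryGroup (Fin n) ℂ) (A : Matrix (Fin n) (Fin n) ℂ) :
    compound k (Unitary.conjStarAlgAut ℂ _ U A) =
      Unitary.conjStarAlgAut ℂ _ (compoundUnitary k U) (compound k A) := by
  simp only [Unitary.conjStarAlgAut_apply, compound_mul, compoundUnitary,
    star_eq_conjTranspose, compound_conjTranspose]

lemma compound_nonneg {A : Matrix (Fin n) (Fin n) ℂ} (hA : 0 ≤ A) : 0 ≤ compound k A := by
  obtain ⟨B, rfl⟩ := CStarAlgebra.nonneg_iff_eq_star_mul_self.mp hA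
  rw [compound_mul, star_eq_conjTranspose, compound_conjTranspose, ← star_eq_conjTranspose]
  exact star_mul_self_nonneg _

lemma compound_posDef {A : Matrix (Fin n) (Fin n) ℂ} (hA : A.PosDef) : (compound k A).PosDef := by
  have h := compound_nonneg (k := k) hA.posSemidef.nonneg
  rw [(nonneg_iff_posSemidef.mp h).posDef_iff_isUnit]
  obtain ⟨B, hB⟩ := hA.isUnit.exists_right_inv
  exact IsUnit.of_mul_eq_one (compound k B) (by rw [← compound_mul, hB, compound_one])

lemma PosSemidef.rpow_eq {n : Type*} [Fintype n] [DecidableEq n] {A : Matrix n n ℂ}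
    (hA : A.PosSemidef) (r : ℝ) :
    A ^ r = Unitary.conjStarAlgAut ℂ _ hA.isHermitian.eigenvectorUnitary
      (diagonal fun i => ((hA.isHermitian.eigenvalues i ^ r : ℝ) : ℂ)) := by
  rw [CFC.rpow_eq_cfc_real hA.nonneg, hA.isHermitian.cfc_eq]
  rfl

/-- After diagonalization this is multiplicativity of `x ↦ x ^ r` over products of eigenvalues,
since the compound of a unitary is unitary. -/
lemma compound_rpow {A : Matrix (Fin n) (Fin n) ℂ} (hA : 0 ≤ A) (r : ℝ) :
    compound k (A ^ r) = compound k A ^ r := by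
  have hA' := nonneg_iff_posSemidef.mp hA
  have hev (i) : 0 ≤ hA'.isHermitian.eigenvalues i := hA'.eigenvalues_nonneg i
  conv_rhs => rw [hA'.isHermitian.spectral_theorem]
  have hd : compound k (diagonal (RCLike.ofReal ∘ hA'.isHermitian.eigenvalues) :
      Matrix (Fin n) (Fin n) ℂ) = diagonal fun i => ((∏ l, hA'.isHermitian.eigenvalues
        ((Fintype.equivFin (Fin k ↪o Fin n)).symm i l) : ℝ) : ℂ) := by
    rw [compound_diagonal]
    simp
  have hd0 : (0 : Matrix (Fin n) (Fin n) ℂ) ≤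
      diagonal (RCLike.ofReal ∘ hA'.isHermitian.eigenvalues) := by
    rw [nonneg_iff_posSemidef, posSemidef_diagonal_iff]
    simpa using hev
  rw [hA'.rpow_eq, compound_conjStarAlgAut, compound_conjStarAlgAut,
    conjStarAlgAut_rpow _ (compound_nonneg hd0), hd,
    diagonal_rpow (fun i => Finset.prod_nonneg fun l _ => hev _), compound_diagonal]
  congr 2
  ext i
  rw [← Real.finsetProd_rpow _ _ fun l _ => hev _]
  push_cast
  rfl

lemma _root_.StrictMono.val_le_val_apply {m : ℕ} {f : Fin k → Fin m} (hf : StrictMono f)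
    (i : Fin k) : (i : ℕ) ≤ f i := by
  obtain ⟨a, ha⟩ := i
  induction a with
  | zero => exact Nat.zero_le _
  | succ a ih =>
    have h := ih (Nat.lt_of_succ_lt ha)
    have h' : f ⟨a, Nat.lt_of_succ_lt ha⟩ < f ⟨a + 1, ha⟩ := hf (by simp [Fin.lt_def])
    rw [Fin.lt_def] at h'
    simp only at h ⊢
    omega

/-- Once sorted, an injective choice of indices has its `i`-th entry at least `i`, so the first `k`
values dominate factor by factor. -/
lemma prod_le_prod_castLE_of_antitone {m : ℕ} {f : Fin m → ℝ} (hf : Antitone f)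
    (hf0 : ∀ i, 0 ≤ f i) (hk : k ≤ m) {j : Fin k → Fin m} (hj : Function.Injective j) :
    ∏ i, f (j i) ≤ ∏ i : Fin k, f (Fin.castLE hk i) := by
  have hmono : StrictMono (j ∘ Tuple.sort j) :=
    (Tuple.monotone_sort j).strictMono_of_injective (hj.comp (Tuple.sort j).injective)
  rw [← Equiv.prod_comp (Tuple.sort j)]
  refine Finset.prod_le_prod (fun i _ => hf0 _) fun i _ => hf ?_
  rw [Fin.le_def]
  exact hmono.val_le_val_apply i

/-- The eigenvalues of the compound are the products of eigenvalues of `A` over index sets, and the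
first indices give the largest. The order is `i + 1` because indices start at zero. -/
lemma norm_compound {A : Matrix (Fin n) (Fin n) ℂ} (hA : A.PosSemidef)
    (i : Fin (Fintype.card (Fin n))) :
    ‖compound (i + 1) A‖ = ∏ l ∈ Finset.Iic i, hA.isHermitian.eigenvalues₀ l := by
  set e : Fin (Fintype.card (Fin n)) ≃ Fin n := Fintype.equivOfCardEq (Fintype.card_fin _)
  set ev := hA.isHermitian.eigenvalues₀
  have hk : (i : ℕ) + 1 ≤ Fintype.card (Fin n) := i.2
  have hev0 (l) : 0 ≤ ev l := by
    have := hA.eigenvalues_nonneg (e l)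
    simpa [IsHermitian.eigenvalues, e, ev] using this
  have hprod : ∏ l ∈ Finset.Iic i, ev l = ∏ l : Fin (i + 1), ev (Fin.castLE hk l) := by
    have himage : Finset.Iic i = Finset.univ.map (Fin.castLEEmb hk) := by
      ext l
      simp only [Finset.mem_Iic, Finset.mem_map, Finset.mem_univ, true_and, Fin.castLEEmb_apply]
      constructor
      · intro h
        exact ⟨⟨l, Nat.lt_succ_of_le h⟩, rfl⟩
      · rintro ⟨a, rfl⟩
        exact Nat.le_of_lt_succ a.2
    rw [himage, Finset.prod_map]
    rfl
  have hspec := hA.isHermitian.spectral_theorem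
  have hnorm : ‖compound (i + 1) A‖ =
      ‖fun j => ((∏ l, ev (e.symm ((Fintype.equivFin (Fin (i + 1) ↪o Fin n)).symm j l)) : ℝ) : ℂ)‖ := by
    conv_lhs => rw [hspec]
    rw [compound_conjStarAlgAut, Unitary.conjStarAlgAut_apply, ← Unitary.coe_star, CStarRing.norm_mul_coe_unitary,
      CStarRing.norm_coe_unitary_mul, compound_diagonal, l2_opNorm_diagonal]
    congr 1
    ext j
    simp [IsHermitian.eigenvalues, e, ev]
  rw [hnorm, hprod]
  refine le_antisymm ?_ ?_
  · rw [pi_norm_le_iff_of_nonneg (Finset.prod_nonneg fun l _ => hev0 _)]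
    intro j
    rw [Complex.norm_real, Real.norm_of_nonneg (Finset.prod_nonneg fun l _ => hev0 _)]
    exact prod_le_prod_castLE_of_antitone hA.isHermitian.eigenvalues₀_antitone hev0 hk
      (e.symm.injective.comp (RelEmbedding.injective _))
  -- The positions of the largest eigenvalues attain the bound. The relabelling `e` need not be
  -- monotone, so they are sorted to give an admissible index of the compound.
  · let r : Fin (i + 1) → Fin n := fun l => e (Fin.castLE hk l)
    have hr : Function.Injective r := e.injective.comp (Fin.castLE_injective hk)
    have hmono : StrictMono (r ∘ Tuple.sort r) :=
      (Tuple.monotone_sort r).strictMono_of_injective (hr.comp (Tuple.sort r).injective)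
    have h := norm_le_pi_norm (fun j => ((∏ l, ev (e.symm
      ((Fintype.equivFin (Fin (i + 1) ↪o Fin n)).symm j l)) : ℝ) : ℂ))
      (Fintype.equivFin _ (OrderEmbedding.ofStrictMono _ hmono))
    rw [Complex.norm_real, Real.norm_of_nonneg (Finset.prod_nonneg fun l _ => hev0 _)] at h
    refine le_trans (le_of_eq ?_) h
    rw [← Equiv.prod_comp (Tuple.sort r)]
    simp [r]

end Matrix

/-! ### Determinants and the top eigenvalue of positive semidefinite matrices. -/

namespace Matrix

lemma PosSemidef.norm_det_rpow {n : Type*} [Fintype n] [DecidableEq n] {A : Matrix n n ℂ}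
    (hA : A.PosSemidef) (r : ℝ) : ‖(A ^ r).det‖ = ‖A.det‖ ^ r := by
  have hev (i) : 0 ≤ hA.isHermitian.eigenvalues i := hA.eigenvalues_nonneg i
  rw [hA.rpow_eq, Unitary.conjStarAlgAut_apply, det_mul_comm, ← mul_assoc,
    Unitary.coe_star_mul_self, one_mul, det_diagonal, hA.isHermitian.det_eq_prod_eigenvalues,
    norm_prod, norm_prod, ← Real.finsetProd_rpow _ _ fun i _ => norm_nonneg _]
  refine Finset.prod_congr rfl fun i _ => ?_
  rw [Complex.norm_real, Real.norm_of_nonneg (Real.rpow_nonneg (hev i) r)]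
  congr 1
  exact (RCLike.norm_of_nonneg (hev i)).symm

lemma PosSemidef.prod_eigenvalues₀ {n : ℕ} {A : Matrix (Fin n) (Fin n) ℂ} (hA : A.PosSemidef) :
    ∏ i, hA.isHermitian.eigenvalues₀ i = ‖A.det‖ := by
  have hev (i) : 0 ≤ hA.isHermitian.eigenvalues i := hA.eigenvalues_nonneg i
  rw [hA.isHermitian.det_eq_prod_eigenvalues, norm_prod]
  simp only [RCLike.norm_of_nonneg (hev _)]
  exact (Equiv.prod_comp _ _).symm

lemma PosSemidef.norm_eq_eigenvalues₀ {n : ℕ} {A : Matrix (Fin n) (Fin n) ℂ} (hA : A.PosSemidef)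
    (h0 : 0 < Fintype.card (Fin n)) : ‖A‖ = hA.isHermitian.eigenvalues₀ ⟨0, h0⟩ := by
  set e : Fin (Fintype.card (Fin n)) ≃ Fin n := Fintype.equivOfCardEq (Fintype.card_fin _)
  have hev (i) : 0 ≤ hA.isHermitian.eigenvalues i := hA.eigenvalues_nonneg i
  have he : hA.isHermitian.eigenvalues₀ ⟨0, h0⟩ = hA.isHermitian.eigenvalues (e ⟨0, h0⟩) := by
    simp [IsHermitian.eigenvalues, e]
  have hspec := hA.isHermitian.spectral_theorem
  conv_lhs => rw [hspec]
  rw [Unitary.conjStarAlgAut_apply, ← Unitary.coe_star, CStarRing.norm_mul_coe_unitary,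
    CStarRing.norm_coe_unitary_mul, l2_opNorm_diagonal]
  refine le_antisymm ?_ ?_
  · rw [pi_norm_le_iff_of_nonneg (he ▸ hev _)]
    intro i
    refine (RCLike.norm_of_nonneg (hev i)).trans_le ?_
    exact hA.isHermitian.eigenvalues₀_antitone (Nat.zero_le _)
  · rw [he]
    refine (RCLike.norm_of_nonneg (K := ℂ) (hev _)).symm.trans_le ?_
    exact norm_le_pi_norm (RCLike.ofReal ∘ hA.isHermitian.eigenvalues : Fin n → ℂ) (e ⟨0, h0⟩)

end Matrix

/-! ### Reduction of log-majorization to norms of compounds and determinants. -/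

namespace QuasiMean

open Matrix

variable {n : ℕ}

lemma logMajorizedBy_of_norm_compound_le {X Y : Matrix (Fin n) (Fin n) ℂ} (hX : 0 ≤ X)
    (hY : 0 ≤ Y) (h : ∀ k, ‖compound k X‖ ≤ ‖compound k Y‖) (hdet : ‖X.det‖ = ‖Y.det‖) :
    LogMajorizedBy X Y := by
  refine ⟨nonneg_iff_posSemidef.mp hX, nonneg_iff_posSemidef.mp hY, fun k => ?_, ?_⟩
  · rw [← norm_compound (nonneg_iff_posSemidef.mp hX), ← norm_compound (nonneg_iff_posSemidef.mp hY)]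
    exact h _
  · rw [(nonneg_iff_posSemidef.mp hX).prod_eigenvalues₀,
      (nonneg_iff_posSemidef.mp hY).prod_eigenvalues₀, hdet]

lemma LogMajorizedBy.norm_le {X Y : Matrix (Fin n) (Fin n) ℂ} (hn : 0 < n)
    (h : LogMajorizedBy X Y) : ‖X‖ ≤ ‖Y‖ := by
  obtain ⟨hX, hY, h, -⟩ := h
  have h0 : 0 < Fintype.card (Fin n) := by simpa using hn
  rw [hX.norm_eq_eigenvalues₀ h0, hY.norm_eq_eigenvalues₀ h0]
  have hIic : Finset.Iic (⟨0, h0⟩ : Fin (Fintype.card (Fin n))) = {⟨0, h0⟩} := by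
    ext i
    simp [Fin.le_def, Fin.ext_iff]
  simpa [hIic] using h ⟨0, h0⟩

lemma geomMean_nonneg (α : ℝ) (A B : Matrix (Fin n) (Fin n) ℂ) : 0 ≤ geomMean α A B :=
  rpow_conj_nonneg A (Matrix.rpow_nonneg (A ^ (-(1 / 2) : ℝ) * B * A ^ (-(1 / 2) : ℝ)) α) (1 / 2)

lemma spectralMean_nonneg (α : ℝ) (A B : Matrix (Fin n) (Fin n) ℂ) : 0 ≤ spectralMean α A B :=
  rpow_conj_nonneg (geomMean α (A ^ (-1 : ℝ)) B) (Matrix.rpow_nonneg A (2 * (1 - α))) (1 / 2)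

lemma quasiSpectralMean_nonneg (α p : ℝ) (A B : Matrix (Fin n) (Fin n) ℂ) :
    0 ≤ quasiSpectralMean α p A B := CFC.rpow_nonneg

lemma renyiMean_nonneg (α p : ℝ) (A B : Matrix (Fin n) (Fin n) ℂ) :
    0 ≤ renyiMean α p A B := CFC.rpow_nonneg

lemma compound_geomMean (k : ℕ) (α : ℝ) {A B : Matrix (Fin n) (Fin n) ℂ} (hA : 0 ≤ A)
    (hB : 0 ≤ B) : compound k (geomMean α A B) = geomMean α (compound k A) (compound k B) := by
  simp only [geomMean, compound_mul, compound_rpow hA, compound_rpow (rpow_conj_nonneg A hB _)]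

lemma compound_spectralMean (k : ℕ) (α : ℝ) {A B : Matrix (Fin n) (Fin n) ℂ} (hA : 0 ≤ A)
    (hB : 0 ≤ B) :
    compound k (spectralMean α A B) = spectralMean α (compound k A) (compound k B) := by
  simp only [spectralMean, compound_mul, compound_rpow hA, compound_rpow (geomMean_nonneg _ _ _),
    compound_geomMean k α (Matrix.rpow_nonneg A _) hB]

lemma compound_quasiSpectralMean (k : ℕ) (α p : ℝ) {A B : Matrix (Fin n) (Fin n) ℂ} (hA : 0 ≤ A)
    (hB : 0 ≤ B) :
    compound k (quasiSpectralMean α p A B) =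
      quasiSpectralMean α p (compound k A) (compound k B) := by
  simp only [quasiSpectralMean, compound_rpow (spectralMean_nonneg _ _ _),
    compound_spectralMean k α (Matrix.rpow_nonneg A _) (Matrix.rpow_nonneg B _),
    compound_rpow hA, compound_rpow hB]

lemma compound_renyiMean (k : ℕ) (α p : ℝ) {A B : Matrix (Fin n) (Fin n) ℂ} (hA : 0 ≤ A)
    (hB : 0 ≤ B) :
    compound k (renyiMean α p A B) = renyiMean α p (compound k A) (compound k B) := by
  simp only [renyiMean, compound_mul, compound_rpow hA, compound_rpow hB,
    compound_rpow (rpow_conj_nonneg A (Matrix.rpow_nonneg B _) _)]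

lemma norm_det_renyiMean {α p : ℝ} (hp : 0 < p) {A B : Matrix (Fin n) (Fin n) ℂ} (hA : A.PosDef)
    (hB : 0 ≤ B) : ‖(renyiMean α p A B).det‖ = ‖A.det‖ ^ (1 - α) * ‖B.det‖ ^ α := by
  have ha : 0 < ‖A.det‖ := norm_pos_iff.mpr hA.det_pos.ne'
  rw [renyiMean, (nonneg_iff_posSemidef.mp (rpow_conj_nonneg A (Matrix.rpow_nonneg B _) _)).norm_det_rpow]
  simp only [det_mul, norm_mul, hA.posSemidef.norm_det_rpow,
    (nonneg_iff_posSemidef.mp hB).norm_det_rpow]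
  rw [mul_right_comm, ← Real.rpow_add ha, Real.mul_rpow (by positivity) (by positivity),
    ← Real.rpow_mul ha.le, ← Real.rpow_mul (norm_nonneg _)]
  congr 2 <;> field_simp
  ring

lemma norm_det_quasiSpectralMean {α p : ℝ} (hp : 0 < p) {A B : Matrix (Fin n) (Fin n) ℂ}
    (hA : A.PosDef) (hB : 0 ≤ B) :
    ‖(quasiSpectralMean α p A B).det‖ = ‖A.det‖ ^ (1 - α) * ‖B.det‖ ^ α := by
  have ha : 0 < ‖A.det‖ := norm_pos_iff.mpr hA.det_pos.ne'
  have hA' := hA.posSemidef.nonneg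
  rw [quasiSpectralMean, (nonneg_iff_posSemidef.mp (spectralMean_nonneg _ _ _)).norm_det_rpow,
    spectralMean]
  simp only [det_mul, norm_mul, (nonneg_iff_posSemidef.mp (geomMean_nonneg _ _ _)).norm_det_rpow,
    rpow_rpow hA', hA.posSemidef.norm_det_rpow]
  rw [geomMean]
  simp only [det_mul, norm_mul,
    (nonneg_iff_posSemidef.mp (rpow_conj_nonneg A (Matrix.rpow_nonneg B p) _)).norm_det_rpow,
    rpow_rpow hA', hA.posSemidef.norm_det_rpow, (nonneg_iff_posSemidef.mp hB).norm_det_rpow]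
  generalize ‖A.det‖ = a at *
  have hb := norm_nonneg B.det
  generalize ‖B.det‖ = b at *
  have hmul (s y : ℝ) : a ^ s * y * a ^ s = a ^ (2 * s) * y := by
    rw [mul_right_comm, ← Real.rpow_add ha, two_mul]
  have hsq {y : ℝ} (hy : 0 ≤ y) (z : ℝ) : y ^ (1 / 2 : ℝ) * z * y ^ (1 / 2 : ℝ) = y * z := by
    rw [mul_right_comm, ← Real.sqrt_eq_rpow, Real.mul_self_sqrt hy]
  have hpow (s t z : ℝ) : (a ^ s * b ^ t) ^ z = a ^ (s * z) * b ^ (t * z) := by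
    rw [Real.mul_rpow (by positivity) (by positivity), ← Real.rpow_mul ha.le, ← Real.rpow_mul hb]
  rw [hsq (by positivity), hmul, hmul, hpow, ← mul_assoc, ← Real.rpow_add ha, mul_right_comm,
    ← Real.rpow_add ha, hpow]
  congr 2 <;> field_simp
  ring

end QuasiMean

/-! ### Loewner order: Loewner–Heinz, a Furuta inequality and its iteration. -/

namespace Matrix

variable {n : Type*} [Fintype n] [DecidableEq n]

lemma norm_le_iff_le_smul_one {A : Matrix n n ℂ} (hA : 0 ≤ A) {c : ℝ} (hc : 0 ≤ c) :
    ‖A‖ ≤ c ↔ A ≤ c • (1 : Matrix n n ℂ) := by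
  rw [CStarAlgebra.norm_le_iff_le_algebraMap A hc hA, Algebra.algebraMap_eq_smul_one]

lemma PosDef.rpow {A : Matrix n n ℂ} (hA : A.PosDef) (r : ℝ) : (A ^ r).PosDef :=
  (nonneg_iff_posSemidef.mp CFC.rpow_nonneg).posDef_iff_isUnit.mpr
    (hA.isUnit.cfcRpow r hA.posSemidef.nonneg)

lemma PosDef.rpow_add {A : Matrix n n ℂ} (hA : A.PosDef) (x y : ℝ) :
    A ^ (x + y) = A ^ x * A ^ y := CFC.rpow_add hA.isUnit

lemma PosDef.rpow_zero {A : Matrix n n ℂ} (hA : A.PosDef) : A ^ (0 : ℝ) = 1 :=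
  CFC.rpow_zero A hA.posSemidef.nonneg

lemma PosDef.rpow_conj_rpow {A : Matrix n n ℂ} (hA : A.PosDef) (x y : ℝ) :
    A ^ x * A ^ y * A ^ x = A ^ (2 * x + y) := by
  rw [← hA.rpow_add, ← hA.rpow_add]
  congr 1
  ring

lemma PosDef.rpow_conj_smul_rpow {A : Matrix n n ℂ} (hA : A.PosDef) (c x y : ℝ) :
    A ^ x * (c • A ^ y) * A ^ x = c • A ^ (2 * x + y) := by
  rw [mul_smul_comm, smul_mul_assoc, hA.rpow_conj_rpow]

lemma PosDef.rpow_conj_conj {A : Matrix n n ℂ} (hA : A.PosDef) (x y : ℝ) (B : Matrix n n ℂ) :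
    A ^ x * (A ^ y * B * A ^ y) * A ^ x = A ^ (x + y) * B * A ^ (x + y) := by
  nth_rewrite 2 [add_comm x y]
  rw [hA.rpow_add, hA.rpow_add]
  simp only [mul_assoc]

lemma rpow_conj_mono (A : Matrix n n ℂ) {B C : Matrix n n ℂ} (h : B ≤ C) (x : ℝ) :
    A ^ x * B * A ^ x ≤ A ^ x * C * A ^ x :=
  conjugate_le_conjugate_of_nonneg h CFC.rpow_nonneg

lemma PosDef.le_conj_of_conj_le {A B C : Matrix n n ℂ} (hA : A.PosDef) {x : ℝ}
    (h : A ^ x * B * A ^ x ≤ C) : B ≤ A ^ (-x) * C * A ^ (-x) := by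
  have h' := rpow_conj_mono A h (-x)
  rwa [hA.rpow_conj_conj, neg_add_cancel, hA.rpow_zero, one_mul, mul_one] at h'

lemma PosDef.rpow_conj {A B : Matrix n n ℂ} (hA : A.PosDef) (hB : B.PosDef) (x : ℝ) :
    (A ^ x * B * A ^ x).PosDef :=
  (nonneg_iff_posSemidef.mp (rpow_conj_nonneg A hB.posSemidef.nonneg x)).posDef_iff_isUnit.mpr
    (((hA.rpow x).isUnit.mul hB.isUnit).mul (hA.rpow x).isUnit)

/-- Loewner–Heinz followed by order reversal under inversion. -/
lemma rpow_neg_le_rpow_neg {A B : Matrix n n ℂ} (hA : A.PosDef) (h : A ≤ B) {s : ℝ}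
    (hs : s ∈ Set.Icc (0 : ℝ) 1) : B ^ (-s) ≤ A ^ (-s) := by
  have hB : B.PosDef := by
    simpa using hA.add_posSemidef (le_iff.mp h)
  have h1 : A ^ s ≤ B ^ s := CFC.rpow_le_rpow hs h
  have key := CStarAlgebra.inv_le_inv (a := (hA.rpow s).isUnit.unit)
    (b := (hB.rpow s).isUnit.unit) CFC.rpow_nonneg h1
  rw [← CFC.rpow_neg_one_eq_inv _ CFC.rpow_nonneg, ← CFC.rpow_neg_one_eq_inv _ CFC.rpow_nonneg,
    IsUnit.unit_spec, IsUnit.unit_spec, rpow_rpow hA.posSemidef.nonneg,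
    rpow_rpow hB.posSemidef.nonneg] at key
  simpa using key

/-- By polar decomposition, `U = M (MᴴM)^(-1/2)` is unitary and conjugates `MᴴM` into `MMᴴ`. -/
lemma mul_conjTranspose_rpow {M : Matrix n n ℂ} (hM : IsUnit M) (s : ℝ) :
    (M * Mᴴ) ^ s = M * (Mᴴ * M) ^ (s - 1) * Mᴴ := by
  have hH : (Mᴴ * M).PosDef :=
    (posSemidef_conjTranspose_mul_self M).posDef_iff_isUnit.mpr (hM.star.mul hM)
  have hH0 := hH.posSemidef.nonneg
  set H := Mᴴ * M with hHdef
  have hsa (r : ℝ) : (H ^ r)ᴴ = H ^ r := (CFC.rpow_nonneg (a := H) (y := r)).isSelfAdjoint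
  have hone : H ^ (1 : ℝ) = H := CFC.rpow_one H hH0
  let U : unitaryGroup n ℂ := ⟨M * H ^ (-(1 / 2) : ℝ), by
    rw [mem_unitaryGroup_iff', star_eq_conjTranspose, conjTranspose_mul, hsa,
      show H ^ (-(1 / 2) : ℝ) * Mᴴ * (M * H ^ (-(1 / 2) : ℝ)) =
        H ^ (-(1 / 2) : ℝ) * H * H ^ (-(1 / 2) : ℝ) by simp only [hHdef, mul_assoc]]
    nth_rewrite 2 [← hone]
    rw [hH.rpow_conj_rpow]
    norm_num [hH.rpow_zero]⟩
  have hU (r : ℝ) : Unitary.conjStarAlgAut ℂ _ U (H ^ r) = M * H ^ (r - 1) * Mᴴ := by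
    rw [Unitary.conjStarAlgAut_apply]
    change M * H ^ (-(1 / 2) : ℝ) * H ^ r * (M * H ^ (-(1 / 2) : ℝ))ᴴ = _
    rw [conjTranspose_mul, hsa, show M * H ^ (-(1 / 2) : ℝ) * H ^ r * (H ^ (-(1 / 2) : ℝ) * Mᴴ) =
      M * (H ^ (-(1 / 2) : ℝ) * H ^ r * H ^ (-(1 / 2) : ℝ)) * Mᴴ by simp only [mul_assoc],
      hH.rpow_conj_rpow]
    congr 3
    ring
  have h1 := hU 1
  rw [sub_self, hH.rpow_zero, mul_one, hone] at h1
  rw [← h1, conjStarAlgAut_rpow _ hH0, hU]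

/-- A case of the **Furuta inequality**. -/
lemma furuta_of_le_one {X Y : Matrix n n ℂ} (hX : X.PosDef) (hY : Y.PosDef) (h : Y ≤ X) {r α : ℝ}
    (hr0 : 0 ≤ r) (hr1 : r ≤ 1) (hα0 : 0 < α) (hα1 : α ≤ 1) :
    (X ^ (r / 2) * Y ^ (1 / α) * X ^ (r / 2)) ^ α ≤ X ^ (1 + r * α) := by
  -- The left side is `(MMᴴ)^α = M (MᴴM)^(α-1) Mᴴ`. Since `Y^r ≤ X^r`, `MᴴM` dominates `Y^(1/α+r)`,
  -- and the power `α - 1 ∈ [-1, 0]` reverses this. What remains is `Y^(1-r+rα)` between powers of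
  -- `X`, with exponent in `[0, 1]`.
  have hα : 1 / α * α = 1 := by field_simp
  set M := X ^ (r / 2) * Y ^ (1 / (2 * α)) with hM
  have hMH : Mᴴ = Y ^ (1 / (2 * α)) * X ^ (r / 2) := by
    rw [hM, conjTranspose_mul]
    congr 1
    · exact (CFC.rpow_nonneg (a := Y)).isSelfAdjoint
    · exact (CFC.rpow_nonneg (a := X)).isSelfAdjoint
  have hMM : M * Mᴴ = X ^ (r / 2) * Y ^ (1 / α) * X ^ (r / 2) := by
    rw [hMH, hM, show 1 / α = 1 / (2 * α) + 1 / (2 * α) by field_simp; norm_num, hY.rpow_add]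
    simp only [mul_assoc]
  have hHH : Mᴴ * M = Y ^ (1 / (2 * α)) * X ^ r * Y ^ (1 / (2 * α)) := by
    rw [hMH, hM]
    nth_rewrite 3 [show r = r / 2 + r / 2 by ring]
    rw [hX.rpow_add]
    simp only [mul_assoc]
  have hle : Y ^ (1 / α + r) ≤ Mᴴ * M := by
    have h1 : Y ^ r ≤ X ^ r := CFC.rpow_le_rpow ⟨hr0, hr1⟩ h
    have h2 := rpow_conj_mono Y h1 (1 / (2 * α))
    rw [hY.rpow_conj_rpow] at h2
    rw [hHH]
    convert h2 using 2
    field_simp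
  have hpow := rpow_neg_le_rpow_neg (hY.rpow _) hle (s := 1 - α) ⟨by linarith, by linarith⟩
  rw [neg_sub, rpow_rpow hY.posSemidef.nonneg] at hpow
  rw [← hMM, mul_conjTranspose_rpow ((hX.rpow _).isUnit.mul (hY.rpow _).isUnit)]
  calc M * (Mᴴ * M) ^ (α - 1) * Mᴴ ≤ M * Y ^ ((1 / α + r) * (α - 1)) * Mᴴ :=
        star_right_conjugate_le_conjugate hpow M
    _ = X ^ (r / 2) * Y ^ (1 - r + r * α) * X ^ (r / 2) := by
        have h3 : Y ^ (1 / (2 * α)) * Y ^ ((1 / α + r) * (α - 1)) * Y ^ (1 / (2 * α)) =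
            Y ^ (1 - r + r * α) := by
          rw [hY.rpow_conj_rpow]
          congr 1
          field_simp
          ring
        rw [← h3, hMH, hM]
        simp only [mul_assoc]
    _ ≤ X ^ (r / 2) * X ^ (1 - r + r * α) * X ^ (r / 2) :=
        rpow_conj_mono X (CFC.rpow_le_rpow ⟨by nlinarith, by nlinarith⟩ h) _
    _ = X ^ (1 + r * α) := by
        rw [hX.rpow_conj_rpow]
        congr 1
        ring

/-- Each Furuta step conjugates by a further `D^(s/2)`. The requirement `r ≤ 1` becomes `s ≤ β +
ksα`, so it persists once `s ≤ β`. -/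
lemma rpow_conj_natCast_mul_le {C D : Matrix n n ℂ} (hC : C.PosDef) (hD : D.PosDef) {α β s : ℝ}
    (hα0 : 0 < α) (hα1 : α ≤ 1) (hs : 0 ≤ s) (hsβ : s ≤ β) (hβ : 0 < β)
    (h : C ^ α ≤ D ^ β) (k : ℕ) :
    (D ^ (k * s / 2) * C * D ^ (k * s / 2)) ^ α ≤ D ^ (β + k * s * α) := by
  induction k with
  | zero => simpa [hD.rpow_zero] using h
  | succ k ih =>
    set E := D ^ (k * s / 2) * C * D ^ (k * s / 2) with hE
    have hEpos : E.PosDef := hD.rpow_conj hC _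
    have hpos : 0 < β + k * s * α := by positivity
    have hge : s ≤ β + k * s * α := hsβ.trans (le_add_of_nonneg_right (by positivity))
    -- This `r` makes the conjugating power of the larger matrix equal to `D^(s/2)`.
    have key := furuta_of_le_one (hD.rpow _) (hEpos.rpow α) ih (r := s / (β + k * s * α))
      (by positivity) ((div_le_one hpos).mpr hge) hα0 hα1
    rw [rpow_rpow hD.posSemidef.nonneg, rpow_rpow hD.posSemidef.nonneg,
      rpow_rpow hEpos.posSemidef.nonneg, mul_one_div_cancel hα0.ne',
      CFC.rpow_one E hEpos.posSemidef.nonneg,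
      show (β + k * s * α) * (s / (β + k * s * α) / 2) = s / 2 by field_simp, hE,
      hD.rpow_conj_conj] at key
    have h1 : ((k + 1 : ℕ) : ℝ) * s / 2 = s / 2 + k * s / 2 := by
      push_cast
      ring
    have h2 : β + ((k + 1 : ℕ) : ℝ) * s * α =
        (β + k * s * α) * (1 + s / (β + k * s * α) * α) := by
      push_cast
      field_simp
      ring
    rw [h1, h2]
    exact key

lemma rpow_half_conj_rpow_le {C D : Matrix n n ℂ} (hC : C.PosDef) (hD : D.PosDef) {α : ℝ}
    (hα0 : 0 < α) (hα1 : α ≤ 1 / 2) (h : C ^ α ≤ D ^ (1 - 2 * α)) :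
    (D ^ (1 / 2 : ℝ) * C * D ^ (1 / 2 : ℝ)) ^ α ≤ D ^ (1 - α) := by
  rcases hα1.eq_or_lt with rfl | hlt
  -- At `α = 1/2` the exponent `1 - 2α` vanishes and leaves no positive step length, but the
  -- hypothesis then gives `C ≤ 1` through norms.
  · have hC0 := hC.posSemidef.nonneg
    have h0 : C ^ (1 / 2 : ℝ) ≤ (1 : ℝ) • (1 : Matrix n n ℂ) := by
      rw [one_smul, ← hD.rpow_zero]
      convert h using 2
      norm_num
    rw [← norm_le_iff_le_smul_one (rpow_nonneg C _) zero_le_one] at h0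
    have hn : ‖C ^ (1 / 2 : ℝ)‖ = ‖C‖ ^ (1 / 2 : ℝ) := CFC.norm_rpow C (by norm_num) hC0
    have h1 : ‖C‖ ≤ 1 := by
      by_contra! hgt
      exact absurd (hn ▸ h0) (not_le.mpr (Real.one_lt_rpow hgt (by norm_num)))
    rw [norm_le_iff_le_smul_one hC0 zero_le_one, one_smul, ← hD.rpow_zero] at h1
    have h2 := rpow_conj_mono D h1 (1 / 2)
    rw [hD.rpow_conj_rpow] at h2
    have h3 := CFC.rpow_le_rpow (p := 1 / 2) ⟨by norm_num, by norm_num⟩ h2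
    rw [rpow_rpow hD.posSemidef.nonneg] at h3
    convert h3 using 2
    norm_num
  -- With `N` steps of length `s = 1/N ≤ 1 - 2α`, the total conjugation is by `D^(1/2)` and the
  -- exponent reaches `1 - 2α + α = 1 - α`.
  · obtain ⟨N, hN⟩ := exists_nat_gt (1 / (1 - 2 * α))
    have hβ : 0 < 1 - 2 * α := by linarith
    have hN0 : (0 : ℝ) < N := (by positivity : (0 : ℝ) < 1 / (1 - 2 * α)).trans hN
    have hs : 1 / (N : ℝ) ≤ 1 - 2 * α := by
      rw [div_le_iff₀ hN0]
      rw [div_lt_iff₀ hβ] at hN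
      linarith
    have key := rpow_conj_natCast_mul_le hC hD hα0 (by linarith) (by positivity) hs hβ h N
    rw [mul_one_div_cancel hN0.ne'] at key
    convert key using 2
    ring

/-- By homogeneity: rescale `C` by `c^(-1/α)` to normalize the constant. -/
lemma rpow_half_conj_rpow_le_smul {C D : Matrix n n ℂ} (hC : C.PosDef) (hD : D.PosDef) {α c : ℝ}
    (hα0 : 0 < α) (hα1 : α ≤ 1 / 2) (hc : 0 < c) (h : C ^ α ≤ c • D ^ (1 - 2 * α)) :
    (D ^ (1 / 2 : ℝ) * C * D ^ (1 / 2 : ℝ)) ^ α ≤ c • D ^ (1 - α) := by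
  have hC0 := hC.posSemidef.nonneg
  have hs : 0 < (c⁻¹) ^ (1 / α) := by positivity
  have hsα : ((c⁻¹) ^ (1 / α)) ^ α = c⁻¹ := by
    rw [← Real.rpow_mul (by positivity), one_div_mul_cancel hα0.ne', Real.rpow_one]
  have key := rpow_half_conj_rpow_le (C := (c⁻¹) ^ (1 / α) • C) (hC.smul hs) hD hα0 hα1 (by
    rw [smul_rpow hC0 hs.le, hsα]
    have := smul_le_smul_of_nonneg_left h (inv_nonneg.mpr hc.le)
    rwa [inv_smul_smul₀ hc.ne'] at this)
  rw [mul_smul_comm, smul_mul_assoc, smul_rpow (rpow_conj_nonneg _ hC0 _) hs.le, hsα] at key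
  have := smul_le_smul_of_nonneg_left key hc.le
  rwa [smul_inv_smul₀ hc.ne'] at this

end Matrix

/-! ### Positive definite perturbations from above. -/

namespace Matrix

variable {n : Type*} [Fintype n] [DecidableEq n]

lemma rpow_add_smul_one_eq_cfc {B : Matrix n n ℂ} (hB : 0 ≤ B) (r : ℝ) {ε : ℝ} (hε : 0 ≤ ε)
    (z : ℝ) : (B ^ r + ε • (1 : Matrix n n ℂ)) ^ z = cfc (fun x : ℝ => (x ^ r + ε) ^ z) B := by
  have h1 : B ^ r + ε • (1 : Matrix n n ℂ) = cfc (fun x : ℝ => x ^ r + ε) B := by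
    rw [cfc_add_const ε _ B (B.continuousOn_real_spectrum _) hB.isSelfAdjoint,
      CFC.rpow_eq_cfc_real hB, Algebra.algebraMap_eq_smul_one]
  have h0 : 0 ≤ B ^ r + ε • (1 : Matrix n n ℂ) :=
    add_nonneg (rpow_nonneg B r) (smul_nonneg hε zero_le_one)
  rw [CFC.rpow_eq_cfc_real h0, h1]
  exact (cfc_comp (fun x : ℝ => x ^ z) (fun x : ℝ => x ^ r + ε) B hB.isSelfAdjoint
    ((B.finite_real_spectrum.image _).continuousOn _) (B.continuousOn_real_spectrum _)).symm

lemma add_smul_one_rpow_le {B : Matrix n n ℂ} (hB : 0 ≤ B) {ε : ℝ} (hε : 0 ≤ ε) {α : ℝ}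
    (hα0 : 0 < α) (hα1 : α ≤ 1) :
    (B + ε • (1 : Matrix n n ℂ)) ^ α ≤ B ^ α + ε ^ α • (1 : Matrix n n ℂ) := by
  have h1 := rpow_add_smul_one_eq_cfc hB 1 hε α
  have h2 := rpow_add_smul_one_eq_cfc hB α (Real.rpow_nonneg hε α) 1
  have h0 : 0 ≤ B ^ α + ε ^ α • (1 : Matrix n n ℂ) :=
    add_nonneg (rpow_nonneg B α) (smul_nonneg (Real.rpow_nonneg hε α) zero_le_one)
  rw [CFC.rpow_one B hB] at h1
  rw [CFC.rpow_one _ h0] at h2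
  rw [h1, h2]
  refine cfc_mono (fun x hx => ?_) (B.continuousOn_real_spectrum _) (B.continuousOn_real_spectrum _)
  have hx0 : 0 ≤ x := spectrum_nonneg_of_nonneg hB hx
  rw [Real.rpow_one, Real.rpow_one]
  exact Real.rpow_add_le_add_rpow hx0 hε hα0.le hα1

/-- A positive definite perturbation `(B ^ r + ε) ^ (1 / r)` of a positive semidefinite matrix. -/
noncomputable def rpowPerturb (r ε : ℝ) (B : Matrix n n ℂ) : Matrix n n ℂ :=
  (B ^ r + ε • (1 : Matrix n n ℂ)) ^ (1 / r)

lemma posDef_rpowPerturb (r : ℝ) {ε : ℝ} (hε : 0 < ε) (B : Matrix n n ℂ) :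
    (rpowPerturb r ε B).PosDef :=
  PosDef.rpow (PosDef.posSemidef_add (nonneg_iff_posSemidef.mp (rpow_nonneg B r))
    (PosDef.one.smul hε)) _

/-- The perturbation is affine in `ε` at the one power `r`, so choosing `r` as the power of `B` in a
mean makes that mean easy to bound. -/
lemma rpowPerturb_rpow {r ε : ℝ} (hr : 0 < r) (hε : 0 < ε) (B : Matrix n n ℂ) :
    rpowPerturb r ε B ^ r = B ^ r + ε • (1 : Matrix n n ℂ) := by
  have h0 : 0 ≤ B ^ r + ε • (1 : Matrix n n ℂ) :=
    add_nonneg (rpow_nonneg B r) (smul_nonneg hε.le zero_le_one)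
  rw [rpowPerturb, rpow_rpow h0, one_div_mul_cancel hr.ne', CFC.rpow_one _ h0]

lemma rpow_le_rpowPerturb_rpow {r ε s : ℝ} (hr : 0 < r) (hε : 0 < ε) (hs : 0 < s)
    {B : Matrix n n ℂ} (hB : 0 ≤ B) : B ^ s ≤ rpowPerturb r ε B ^ s := by
  have h0 : 0 ≤ B ^ r + ε • (1 : Matrix n n ℂ) :=
    add_nonneg (rpow_nonneg B r) (smul_nonneg hε.le zero_le_one)
  rw [rpowPerturb, rpow_rpow h0, rpow_add_smul_one_eq_cfc hB r hε.le, CFC.rpow_eq_cfc_real hB]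
  refine cfc_mono (fun x hx => ?_) (B.continuousOn_real_spectrum _) (B.continuousOn_real_spectrum _)
  have hx0 : 0 ≤ x := spectrum_nonneg_of_nonneg hB hx
  calc x ^ s = (x ^ r) ^ (1 / r * s) := by
        rw [← Real.rpow_mul hx0]
        congr 1
        field_simp
    _ ≤ (x ^ r + ε) ^ (1 / r * s) :=
        Real.rpow_le_rpow (Real.rpow_nonneg hx0 r) (by linarith) (by positivity)

end Matrix

/-! ### Norm inequalities between the two means. -/

namespace QuasiMean

open Matrix

variable {n : ℕ} {α p q : ℝ} {A B : Matrix (Fin n) (Fin n) ℂ}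

/-- The matrix `A^{(1-α)q/2} B^{αq} A^{(1-α)q/2}`, whose `1/q`-th power is the Rényi mean. -/
noncomputable def renyiCore (α q : ℝ) (A B : Matrix (Fin n) (Fin n) ℂ) : Matrix (Fin n) (Fin n) ℂ :=
  A ^ ((1 - α) / 2 * q) * B ^ (α * q) * A ^ ((1 - α) / 2 * q)

/-- The matrix `A^{p(1/2-α)} (A^{p/2} B^p A^{p/2})^α A^{p(1/2-α)}`. For positive definite `A`, its
`1/p`-th power has the same spectrum as the quasi-extension of the spectral geometric mean. -/
noncomputable def spectralCore (α p : ℝ) (A B : Matrix (Fin n) (Fin n) ℂ) : Matrix (Fin n) (Fin n) ℂ :=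
  A ^ (p * (1 / 2 - α)) * (A ^ (p / 2) * B ^ p * A ^ (p / 2)) ^ α * A ^ (p * (1 / 2 - α))

lemma renyiCore_nonneg (α q : ℝ) (A B : Matrix (Fin n) (Fin n) ℂ) : 0 ≤ renyiCore α q A B :=
  rpow_conj_nonneg A (Matrix.rpow_nonneg B _) _

lemma spectralCore_nonneg (α p : ℝ) (A B : Matrix (Fin n) (Fin n) ℂ) : 0 ≤ spectralCore α p A B :=
  rpow_conj_nonneg A (Matrix.rpow_nonneg (A ^ (p / 2) * B ^ p * A ^ (p / 2)) α) _

lemma norm_renyiMean (hq : 0 < q) (A B : Matrix (Fin n) (Fin n) ℂ) :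
    ‖renyiMean α q A B‖ = ‖renyiCore α q A B‖ ^ (1 / q) :=
  CFC.norm_rpow (renyiCore α q A B) (by positivity) (renyiCore_nonneg _ _ _ _)

/-- With `X = Z G^(1/2)` these are the norms of `X*X` and `XX*`. This moves the outer square roots
of the geometric mean inside, where they combine. -/
lemma norm_rpow_half_conj_mul_self {G Z : Matrix (Fin n) (Fin n) ℂ} (hG : 0 ≤ G)
    (hZ : IsSelfAdjoint Z) :
    ‖G ^ (1 / 2 : ℝ) * (Z * Z) * G ^ (1 / 2 : ℝ)‖ = ‖Z * G * Z‖ := by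
  have hs : IsSelfAdjoint (G ^ (1 / 2 : ℝ)) := (Matrix.rpow_nonneg G (1 / 2)).isSelfAdjoint
  have hGG : G ^ (1 / 2 : ℝ) * G ^ (1 / 2 : ℝ) = G := by
    rw [rpow_mul_rpow G (by norm_num), add_halves, CFC.rpow_one G hG]
  generalize G ^ (1 / 2 : ℝ) = H at hs hGG
  have h1 : H * (Z * Z) * H = star (Z * H) * (Z * H) := by
    rw [star_mul, hs.star_eq, hZ.star_eq]
    simp only [mul_assoc]
  have h2 : Z * G * Z = (Z * H) * star (Z * H) := by
    rw [star_mul, hs.star_eq, hZ.star_eq, ← hGG]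
    simp only [mul_assoc]
  rw [h1, h2, CStarRing.norm_star_mul_self, CStarRing.norm_self_mul_star]

lemma rpow_conj_geomMean (hA : A.PosDef) (B : Matrix (Fin n) (Fin n) ℂ) :
    A ^ (p * (1 - α)) * geomMean α ((A ^ p) ^ (-1 : ℝ)) B * A ^ (p * (1 - α)) =
      A ^ (p * (1 / 2 - α)) * (A ^ (p / 2) * B * A ^ (p / 2)) ^ α * A ^ (p * (1 / 2 - α)) := by
  have hA0 := hA.posSemidef.nonneg
  have h1 : ((A ^ p) ^ (-1 : ℝ)) ^ (1 / 2 : ℝ) = A ^ (-(p / 2)) := by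
    rw [rpow_rpow hA0, rpow_rpow hA0]
    congr 1
    ring
  have h2 : ((A ^ p) ^ (-1 : ℝ)) ^ (-(1 / 2) : ℝ) = A ^ (p / 2) := by
    rw [rpow_rpow hA0, rpow_rpow hA0]
    congr 1
    ring
  rw [geomMean, h1, h2, hA.rpow_conj_conj, show p * (1 - α) + -(p / 2) = p * (1 / 2 - α) by ring]

lemma norm_quasiSpectralMean (hp : 0 < p) (hA : A.PosDef) (B : Matrix (Fin n) (Fin n) ℂ) :
    ‖quasiSpectralMean α p A B‖ = ‖spectralCore α p A B‖ ^ (1 / p) := by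
  have h1 : ‖quasiSpectralMean α p A B‖ = ‖spectralMean α (A ^ p) (B ^ p)‖ ^ (1 / p) :=
    CFC.norm_rpow (spectralMean α (A ^ p) (B ^ p)) (by positivity) (spectralMean_nonneg _ _ _)
  have h2 : ‖spectralMean α (A ^ p) (B ^ p)‖ = ‖spectralCore α p A B‖ := by
    have hZ : (A ^ p) ^ (2 * (1 - α)) = A ^ (p * (1 - α)) * A ^ (p * (1 - α)) := by
      rw [rpow_rpow hA.posSemidef.nonneg, ← hA.rpow_add]
      congr 1
      ring
    rw [spectralMean, hZ, norm_rpow_half_conj_mul_self (geomMean_nonneg _ _ _)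
      (Matrix.rpow_nonneg A (p * (1 - α))).isSelfAdjoint, rpow_conj_geomMean hA, spectralCore]
  rw [h1, h2]

lemma norm_spectralMean_le_norm_renyiMean (hα0 : 0 < α) (hα1 : α < 1) (hp : 0 < p) (hq : 0 < q)
    (hpq : p ≤ α * q) (hA : A.PosDef) (hB : 0 ≤ B) :
    ‖quasiSpectralMean α p A B‖ ≤ ‖renyiMean α q A B‖ := by
  have hA0 := hA.posSemidef.nonneg
  rw [norm_quasiSpectralMean hp hA, norm_renyiMean hq]
  set N := ‖renyiCore α q A B‖ with hN
  have hN0 : 0 ≤ N := norm_nonneg _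
  have h1 := (norm_le_iff_le_smul_one (renyiCore_nonneg α q A B) hN0).mp hN.ge
  rw [renyiCore] at h1
  have h2 := hA.le_conj_of_conj_le h1
  rw [← hA.rpow_zero, hA.rpow_conj_smul_rpow] at h2
  have h3 := CFC.rpow_le_rpow (p := p / (α * q)) ⟨by positivity, (div_le_one (by positivity)).mpr hpq⟩ h2
  rw [rpow_rpow hB, smul_rpow (Matrix.rpow_nonneg A _) hN0, rpow_rpow hA0,
    mul_div_cancel₀ p (by positivity)] at h3
  have h4 := rpow_conj_mono A h3 (p / 2)
  rw [hA.rpow_conj_smul_rpow] at h4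
  have h5 := CFC.rpow_le_rpow (p := α) ⟨hα0.le, hα1.le⟩ h4
  rw [smul_rpow (Matrix.rpow_nonneg A _) (by positivity), rpow_rpow hA0] at h5
  have h6 := rpow_conj_mono A h5 (p * (1 / 2 - α))
  rw [hA.rpow_conj_smul_rpow, ← Real.rpow_mul hN0] at h6
  have h7 : spectralCore α p A B ≤ N ^ (p / q) • (1 : Matrix (Fin n) (Fin n) ℂ) := by
    rw [← hA.rpow_zero, spectralCore]
    convert h6 using 3
    · field_simp
    · field_simp
      ring
  rw [← norm_le_iff_le_smul_one (spectralCore_nonneg _ _ _ _) (by positivity)] at h7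
  calc ‖spectralCore α p A B‖ ^ (1 / p) ≤ (N ^ (p / q)) ^ (1 / p) :=
        Real.rpow_le_rpow (norm_nonneg _) h7 (by positivity)
    _ = N ^ (1 / q) := by
        rw [← Real.rpow_mul hN0]
        congr 1
        field_simp

lemma norm_renyiMean_le_norm_spectralMean_of_posDef (hα0 : 0 < α) (hα1 : α ≤ 1 / 2) (hp : 0 < p)
    (hq : 0 < q) (hpq : q ≤ p) (hA : A.PosDef) (hB : B.PosDef) :
    ‖renyiMean α q A B‖ ≤ ‖quasiSpectralMean α p A B‖ := by
  have hA0 := hA.posSemidef.nonneg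
  have hB0 := hB.posSemidef.nonneg
  rw [norm_quasiSpectralMean hp hA, norm_renyiMean hq]
  have key : ‖renyiCore α q A B‖ ^ (p / q) ≤ ‖spectralCore α p A B‖ := by
    -- A strictly larger `c` is positive, as the rescaled Furuta bound requires.
    refine le_of_forall_gt_imp_ge_of_dense fun c hc => ?_
    have hc0 : 0 < c := (norm_nonneg _).trans_lt hc
    have h1 := (norm_le_iff_le_smul_one (spectralCore_nonneg α p A B) hc0.le).mp hc.le
    rw [spectralCore] at h1
    have h2 := hA.le_conj_of_conj_le h1
    rw [← hA.rpow_zero, hA.rpow_conj_smul_rpow] at h2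
    -- With `D = A^(-p)`, conjugating by `D^(1/2)` strips `A^(p/2) B^p A^(p/2)` down to `B^p`.
    have h3 := rpow_half_conj_rpow_le_smul (hA.rpow_conj (hB.rpow p) (p / 2)) (hA.rpow (-p)) hα0
      hα1 hc0 (by
        rw [rpow_rpow hA0]
        convert h2 using 3
        ring)
    rw [rpow_rpow hA0, rpow_rpow hA0, hA.rpow_conj_conj,
      show -p * (1 / 2) + p / 2 = 0 by ring, hA.rpow_zero, one_mul, mul_one, rpow_rpow hB0] at h3
    have h4 := CFC.rpow_le_rpow (p := q / p) ⟨by positivity, (div_le_one (by positivity)).mpr hpq⟩ h3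
    rw [rpow_rpow hB0, smul_rpow (Matrix.rpow_nonneg A _) hc0.le, rpow_rpow hA0] at h4
    have h5 := rpow_conj_mono A h4 ((1 - α) / 2 * q)
    rw [hA.rpow_conj_smul_rpow] at h5
    have h6 : renyiCore α q A B ≤ c ^ (q / p) • (1 : Matrix (Fin n) (Fin n) ℂ) := by
      rw [← hA.rpow_zero, renyiCore]
      convert h5 using 3
      · congr 1
        field_simp
      · field_simp
        ring
    rw [← norm_le_iff_le_smul_one (renyiCore_nonneg _ _ _ _) (by positivity)] at h6
    calc ‖renyiCore α q A B‖ ^ (p / q) ≤ (c ^ (q / p)) ^ (p / q) :=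
          Real.rpow_le_rpow (norm_nonneg _) h6 (by positivity)
      _ = c := by
          rw [← Real.rpow_mul hc0.le, div_mul_div_cancel₀ hp.ne', div_self hq.ne', Real.rpow_one]
  calc ‖renyiCore α q A B‖ ^ (1 / q) = (‖renyiCore α q A B‖ ^ (p / q)) ^ (1 / p) := by
        rw [← Real.rpow_mul (norm_nonneg _)]
        congr 1
        field_simp
    _ ≤ ‖spectralCore α p A B‖ ^ (1 / p) :=
        Real.rpow_le_rpow (Real.rpow_nonneg (norm_nonneg _) _) key (by positivity)

lemma norm_renyiMean_mono (hq : 0 < q) {B' : Matrix (Fin n) (Fin n) ℂ}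
    (h : B ^ (α * q) ≤ B' ^ (α * q)) : ‖renyiMean α q A B‖ ≤ ‖renyiMean α q A B'‖ := by
  rw [norm_renyiMean hq, norm_renyiMean hq]
  refine Real.rpow_le_rpow (norm_nonneg _) ?_ (by positivity)
  exact CStarAlgebra.norm_le_norm_of_nonneg_of_le (renyiCore_nonneg _ _ _ _)
    (rpow_conj_mono A h _)

lemma norm_quasiSpectralMean_mono (hα0 : 0 < α) (hα1 : α < 1) (hp : 0 < p) (hA : A.PosDef)
    {B' : Matrix (Fin n) (Fin n) ℂ} (h : B ^ p ≤ B' ^ p) :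
    ‖quasiSpectralMean α p A B‖ ≤ ‖quasiSpectralMean α p A B'‖ := by
  rw [norm_quasiSpectralMean hp hA, norm_quasiSpectralMean hp hA]
  refine Real.rpow_le_rpow (norm_nonneg _) ?_ (by positivity)
  exact CStarAlgebra.norm_le_norm_of_nonneg_of_le (spectralCore_nonneg _ _ _ _)
    (rpow_conj_mono A (CFC.rpow_le_rpow ⟨hα0.le, hα1.le⟩ (rpow_conj_mono A h _)) _)

lemma renyiCore_rpowPerturb_le (hα0 : 0 < α) (hq : 0 < q) (A B : Matrix (Fin n) (Fin n) ℂ) :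
    ∃ K : ℝ, ∀ ε > 0,
      ‖renyiCore α q A (rpowPerturb (α * q) ε B)‖ ≤ ‖renyiCore α q A B‖ + ε * K := by
  refine ⟨‖A ^ ((1 - α) / 2 * q) * A ^ ((1 - α) / 2 * q)‖, fun ε hε => ?_⟩
  have h : renyiCore α q A (rpowPerturb (α * q) ε B) =
      renyiCore α q A B + ε • (A ^ ((1 - α) / 2 * q) * A ^ ((1 - α) / 2 * q)) := by
    rw [renyiCore, rpowPerturb_rpow (by positivity) hε, renyiCore, mul_add, add_mul, mul_smul_comm,
      smul_mul_assoc, mul_one]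
  rw [h]
  refine (norm_add_le _ _).trans ?_
  rw [norm_smul, Real.norm_of_nonneg hε.le]

/-- Operator monotonicity of the power `α`, with `(x + δ)^α ≤ x^α + δ^α` on the spectrum, gives an
explicit modulus of continuity from above. -/
lemma spectralCore_rpowPerturb_le (hα0 : 0 < α) (hα1 : α < 1) (hp : 0 < p) (hA : A.PosDef)
    (B : Matrix (Fin n) (Fin n) ℂ) :
    ∃ K L : ℝ, 0 ≤ K ∧ ∀ ε > 0,
      ‖spectralCore α p A (rpowPerturb p ε B)‖ ≤ ‖spectralCore α p A B‖ + (ε * K) ^ α * L := by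
  have hA0 := hA.posSemidef.nonneg
  refine ⟨‖A ^ p‖, ‖A ^ (p * (1 / 2 - α)) * A ^ (p * (1 / 2 - α))‖, norm_nonneg _, fun ε hε => ?_⟩
  set C := A ^ (p / 2) * B ^ p * A ^ (p / 2) with hC
  have hC0 : 0 ≤ C := rpow_conj_nonneg A (Matrix.rpow_nonneg B p) _
  have hεK : 0 ≤ ε * ‖A ^ p‖ := by positivity
  have h1 : A ^ (p / 2) * rpowPerturb p ε B ^ p * A ^ (p / 2) ≤
      C + (ε * ‖A ^ p‖) • (1 : Matrix (Fin n) (Fin n) ℂ) := by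
    rw [rpowPerturb_rpow hp hε, mul_add, add_mul, mul_smul_comm, smul_mul_assoc, mul_one,
      ← hA.rpow_add, add_halves, mul_smul]
    refine add_le_add_right (smul_le_smul_of_nonneg_left ?_ hε.le) _
    exact (norm_le_iff_le_smul_one (Matrix.rpow_nonneg A p) (norm_nonneg _)).mp le_rfl
  have h2 := (CFC.rpow_le_rpow (p := α) ⟨hα0.le, hα1.le⟩ h1).trans
    (add_smul_one_rpow_le hC0 hεK hα0 hα1.le)
  have h3 := rpow_conj_mono A h2 (p * (1 / 2 - α))
  rw [mul_add, add_mul, mul_smul_comm, smul_mul_assoc, mul_one] at h3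
  refine (CStarAlgebra.norm_le_norm_of_nonneg_of_le (spectralCore_nonneg _ _ _ _) h3).trans ?_
  refine (norm_add_le _ _).trans ?_
  rw [norm_smul, Real.norm_of_nonneg (by positivity)]
  rfl

/-- The perturbation increases every positive power of `B`, so the smaller side is monotone and only
the larger side needs a limit. -/
lemma norm_renyiMean_le_of_forall_posDef (hα0 : 0 < α) (hα1 : α < 1) (hp : 0 < p) (hq : 0 < q)
    (hA : A.PosDef)
    (h : ∀ B : Matrix (Fin n) (Fin n) ℂ, B.PosDef →
      ‖renyiMean α q A B‖ ≤ ‖quasiSpectralMean α p A B‖) (hB : 0 ≤ B) :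
    ‖renyiMean α q A B‖ ≤ ‖quasiSpectralMean α p A B‖ := by
  obtain ⟨K, L, hK, hKL⟩ := spectralCore_rpowPerturb_le hα0 hα1 hp hA B
  have hlim : Filter.Tendsto
      (fun ε : ℝ => (‖spectralCore α p A B‖ + (ε * K) ^ α * L) ^ (1 / p))
      (nhdsWithin 0 (Set.Ioi 0)) (nhds (‖spectralCore α p A B‖ ^ (1 / p))) := by
    refine (Continuous.tendsto' ?_ _ _ ?_).mono_left nhdsWithin_le_nhds
    · refine Continuous.rpow_const ?_ fun _ => Or.inr (by positivity)
      refine continuous_const.add (Continuous.mul ?_ continuous_const)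
      exact (continuous_id.mul continuous_const).rpow_const fun _ => Or.inr hα0.le
    · rw [zero_mul, Real.zero_rpow hα0.ne', zero_mul, add_zero]
  rw [norm_quasiSpectralMean hp hA]
  refine ge_of_tendsto hlim ?_
  filter_upwards [self_mem_nhdsWithin] with ε hε
  refine (norm_renyiMean_mono hq
    (rpow_le_rpowPerturb_rpow hp hε (by positivity) hB)).trans ?_
  refine (h _ (posDef_rpowPerturb p hε B)).trans ?_
  rw [norm_quasiSpectralMean hp hA]
  exact Real.rpow_le_rpow (norm_nonneg _) (hKL ε hε) (by positivity)

lemma norm_quasiSpectralMean_le_of_forall_posDef (hα0 : 0 < α) (hα1 : α < 1) (hp : 0 < p)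
    (hq : 0 < q) (hA : A.PosDef)
    (h : ∀ B : Matrix (Fin n) (Fin n) ℂ, B.PosDef →
      ‖quasiSpectralMean α p A B‖ ≤ ‖renyiMean α q A B‖) (hB : 0 ≤ B) :
    ‖quasiSpectralMean α p A B‖ ≤ ‖renyiMean α q A B‖ := by
  obtain ⟨K, hK⟩ := renyiCore_rpowPerturb_le hα0 hq A B
  have hlim : Filter.Tendsto
      (fun ε : ℝ => (‖renyiCore α q A B‖ + ε * K) ^ (1 / q))
      (nhdsWithin 0 (Set.Ioi 0)) (nhds (‖renyiCore α q A B‖ ^ (1 / q))) := by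
    refine (Continuous.tendsto' ?_ _ _ ?_).mono_left nhdsWithin_le_nhds
    · refine Continuous.rpow_const ?_ fun _ => Or.inr (by positivity)
      fun_prop
    · rw [zero_mul, add_zero]
  rw [norm_renyiMean hq]
  refine ge_of_tendsto hlim ?_
  filter_upwards [self_mem_nhdsWithin] with ε hε
  refine (norm_quasiSpectralMean_mono hα0 hα1 hp hA
    (rpow_le_rpowPerturb_rpow (r := α * q) (by positivity) hε hp hB)).trans ?_
  refine (h _ (posDef_rpowPerturb (α * q) hε B)).trans ?_
  rw [norm_renyiMean hq]
  exact Real.rpow_le_rpow (norm_nonneg _) (hK ε hε) (by positivity)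

end QuasiMean

/-! ### Singular matrices and the support condition. -/

namespace Matrix

section

variable {n : Type*} [Fintype n] [DecidableEq n]

lemma mul_rpow_of_mul_eq {Q C : Matrix n n ℂ} (hC : 0 ≤ C) (h : Q * C = C) {r : ℝ} (hr : r ≠ 0) :
    Q * C ^ r = C ^ r := by
  have h1 : C * C ^ (r - 1) = C ^ r := by
    nth_rewrite 1 [← CFC.rpow_one C hC]
    rw [rpow_mul_rpow C (by simpa using hr)]
    congr 1
    ring
  rw [← h1, ← mul_assoc, h]

lemma rpow_mul_of_mul_eq {Q C : Matrix n n ℂ} (hC : 0 ≤ C) (h : C * Q = C) {r : ℝ} (hr : r ≠ 0) :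
    C ^ r * Q = C ^ r := by
  have h1 : C ^ (r - 1) * C = C ^ r := by
    nth_rewrite 2 [← CFC.rpow_one C hC]
    rw [rpow_mul_rpow C (by simpa using hr)]
    congr 1
    ring
  rw [← h1, mul_assoc, h]

/-- A positive semidefinite matrix `A` is a corner of the positive definite matrix `A + (1 - Q)`,
with `Q` the support projection of `A`. -/
lemma exists_posDef_of_nonneg {A : Matrix n n ℂ} (hA : 0 ≤ A) :
    ∃ D Q : Matrix n n ℂ, D.PosDef ∧ A * Q = A ∧ IsSelfAdjoint Q ∧
      ∀ r : ℝ, r ≠ 0 → A ^ r = D ^ r * Q ∧ A ^ r = Q * D ^ r := by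
  set f : ℝ → ℝ := fun x => if x = 0 then 1 else x with hf
  set g : ℝ → ℝ := fun x => if x = 0 then 0 else 1 with hg
  have hcont := A.continuousOn_real_spectrum
  have hspec {x : ℝ} (hx : x ∈ spectrum ℝ A) : 0 ≤ x := spectrum_nonneg_of_nonneg hA hx
  have hfpos {x : ℝ} (hx : x ∈ spectrum ℝ A) : 0 < f x := by
    simp only [hf]
    split_ifs with h0
    · exact one_pos
    · exact lt_of_le_of_ne (hspec hx) (Ne.symm h0)
  have hD0 : 0 ≤ cfc f A := cfc_nonneg fun x hx => (hfpos hx).le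
  have hD : (cfc f A).PosDef := by
    rw [(nonneg_iff_posSemidef.mp hD0).posDef_iff_isUnit, isUnit_cfc_iff f A (hcont f) hA.isSelfAdjoint]
    exact fun x hx => (hfpos hx).ne'
  refine ⟨cfc f A, cfc g A, hD, ?_, cfc_predicate g A, fun r hr => ?_⟩
  · nth_rewrite 1 [← cfc_id' ℝ A hA.isSelfAdjoint]
    rw [← cfc_mul _ _ A (hcont _) (hcont _)]
    nth_rewrite 2 [← cfc_id' ℝ A hA.isSelfAdjoint]
    refine cfc_congr fun x _ => ?_
    by_cases h0 : x = 0 <;> simp [hg, h0]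
  · have hpow : cfc f A ^ r = cfc (fun x => f x ^ r) A :=
      CFC.cfc_rpow (fun x hx => hfpos hx) (hcont f) hA.isSelfAdjoint
    rw [hpow, ← cfc_mul _ _ A (hcont _) (hcont _), ← cfc_mul _ _ A (hcont _) (hcont _),
      CFC.rpow_eq_cfc_real hA]
    constructor <;> refine cfc_congr fun x _ => ?_ <;> by_cases h0 : x = 0 <;>
      simp [hf, hg, h0, Real.zero_rpow hr]

end

/-- The order of the supports reverses to an inclusion of kernels, applied to each column of `M`. -/
lemma mul_eq_zero_of_supportProj_le {n : ℕ} {A B M : Matrix (Fin n) (Fin n) ℂ}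
    (h : QuasiMean.supportProj B ≤ QuasiMean.supportProj A) (hM : A * M = 0) : B * M = 0 := by
  have hker : LinearMap.ker (toEuclideanLin A) ≤ LinearMap.ker (toEuclideanLin B) := by
    rw [QuasiMean.supportProj, QuasiMean.supportProj,
      Submodule.starProjection_le_starProjection_iff] at h
    simpa using Submodule.orthogonal_le h
  have hcol (j : Fin n) : WithLp.toLp 2 (fun i => M i j) ∈ LinearMap.ker (toEuclideanLin A) := by
    rw [LinearMap.mem_ker, toLpLin_toLp, toLin'_apply]
    have : A *ᵥ (fun i => M i j) = 0 := by
      ext i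
      exact congrFun (congrFun hM i) j
    rw [this]
    rfl
  ext i j
  have h1 := hker (hcol j)
  rw [LinearMap.mem_ker, toLpLin_toLp] at h1
  exact congrArg (fun v : EuclideanSpace ℂ (Fin n) => v i) h1

end Matrix

namespace QuasiMean

open Matrix

variable {n : ℕ} {α p q : ℝ}

/-- If the support of `A` contains that of `B`, then `A` may be replaced by a positive definite
matrix without changing its means with `B`. -/
lemma exists_posDef_means_eq {A B : Matrix (Fin n) (Fin n) ℂ} (hα0 : 0 < α) (hα1 : α < 1)
    (hp : 0 < p) (hq : 0 < q) (hA : 0 ≤ A) (hB : 0 ≤ B) (h : supportProj B ≤ supportProj A) :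
    ∃ D : Matrix (Fin n) (Fin n) ℂ, D.PosDef ∧
      quasiSpectralMean α p A B = quasiSpectralMean α p D B ∧
      renyiMean α q A B = renyiMean α q D B := by
  obtain ⟨D, Q, hD, hAQ, hQ, hpow⟩ := exists_posDef_of_nonneg hA
  have hD0 := hD.posSemidef.nonneg
  have hBQ : B * Q = B := by
    have h1 : B * (1 - Q) = 0 := mul_eq_zero_of_supportProj_le h (by rw [mul_sub, mul_one, hAQ, sub_self])
    rw [mul_sub, mul_one, sub_eq_zero] at h1
    exact h1.symm
  have hQB : Q * B = B := by
    have := congrArg star hBQ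
    rwa [star_mul, hQ.star_eq, hB.isSelfAdjoint.star_eq] at this
  have hl {r : ℝ} (hr : r ≠ 0) : A ^ r = D ^ r * Q := (hpow r hr).1
  have hr {r : ℝ} (hr : r ≠ 0) : A ^ r = Q * D ^ r := (hpow r hr).2
  have hcomm {r : ℝ} (h0 : r ≠ 0) : Q * D ^ r = D ^ r * Q := (hr h0).symm.trans (hl h0)
  have hconj {C : Matrix (Fin n) (Fin n) ℂ} (hQC : Q * C = C) (hCQ : C * Q = C) {r : ℝ}
      (h0 : r ≠ 0) : A ^ r * C * A ^ r = D ^ r * C * D ^ r := by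
    conv_lhs => rw [hl h0, mul_assoc (D ^ r) Q C, hQC, ← hl h0, hr h0, ← mul_assoc,
      mul_assoc (D ^ r) C Q, hCQ]
  have hQconj {C : Matrix (Fin n) (Fin n) ℂ} (hQC : Q * C = C) {r : ℝ} (h0 : r ≠ 0) :
      Q * (D ^ r * C * D ^ r) = D ^ r * C * D ^ r := by
    rw [← mul_assoc, ← mul_assoc, hcomm h0, mul_assoc (D ^ r) Q C, hQC]
  have hconjQ {C : Matrix (Fin n) (Fin n) ℂ} (hCQ : C * Q = C) {r : ℝ} (h0 : r ≠ 0) :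
      D ^ r * C * D ^ r * Q = D ^ r * C * D ^ r := by
    rw [mul_assoc _ (D ^ r) Q, ← hcomm h0, ← mul_assoc, mul_assoc (D ^ r) C Q, hCQ]
  refine ⟨D, hD, ?_, ?_⟩
  -- The powers of `A` in the spectral mean, in the form produced by composing exponents. They must
  -- be nonzero for `A^r = D^r Q`; the projection `Q` is then absorbed by the factors built from
  -- `B`.
  · have e1 : p * -1 * -(1 / 2) ≠ 0 := by nlinarith
    have e2 : p * -1 * (1 / 2) ≠ 0 := by nlinarith
    have e3 : p * (2 * (1 - α)) ≠ 0 := by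
      have : 0 < 1 - α := by linarith
      positivity
    have hQBp := mul_rpow_of_mul_eq hB hQB hp.ne'
    have hBpQ := rpow_mul_of_mul_eq hB hBQ hp.ne'
    set C := D ^ (p * -1 * -(1 / 2)) * B ^ p * D ^ (p * -1 * -(1 / 2)) with hC
    have hC0 : 0 ≤ C := Matrix.rpow_conj_nonneg D (Matrix.rpow_nonneg B p) _
    have hQCα := mul_rpow_of_mul_eq hC0 (hQconj hQBp e1) hα0.ne'
    have hCαQ := rpow_mul_of_mul_eq hC0 (hconjQ hBpQ e1) hα0.ne'
    have hG : geomMean α ((A ^ p) ^ (-1 : ℝ)) (B ^ p) = geomMean α ((D ^ p) ^ (-1 : ℝ)) (B ^ p) := by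
      simp only [geomMean, Matrix.rpow_rpow hA, Matrix.rpow_rpow hD0]
      rw [hconj hQBp hBpQ e1, hconj hQCα hCαQ e2]
    have hG' : geomMean α ((D ^ p) ^ (-1 : ℝ)) (B ^ p) =
        D ^ (p * -1 * (1 / 2)) * C ^ α * D ^ (p * -1 * (1 / 2)) := by
      simp only [geomMean, Matrix.rpow_rpow hD0, hC]
    have hQG := hQconj hQCα e2
    rw [← hG'] at hQG
    have hQGh := mul_rpow_of_mul_eq (geomMean_nonneg _ _ _) hQG (r := 1 / 2) (by norm_num)
    rw [quasiSpectralMean, quasiSpectralMean, spectralMean, spectralMean, hG, rpow_rpow hA p (2 * (1 - α)),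
      rpow_rpow hD0 p (2 * (1 - α)), hl e3, mul_assoc _ (D ^ _ * Q), mul_assoc (D ^ _) Q, hQGh, ← mul_assoc]
  · have e : (1 - α) / 2 * q ≠ 0 := by
      have : 0 < 1 - α := by linarith
      positivity
    have e' : α * q ≠ 0 := by positivity
    rw [renyiMean, renyiMean, hconj (mul_rpow_of_mul_eq hB hQB e') (rpow_mul_of_mul_eq hB hBQ e') e]

lemma supportProj_le_of_posDef {A : Matrix (Fin n) (Fin n) ℂ} (hA : A.PosDef)
    (B : Matrix (Fin n) (Fin n) ℂ) : supportProj B ≤ supportProj A := by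
  have hker : LinearMap.ker (toEuclideanLin A) = ⊥ := by
    rw [LinearMap.ker_eq_bot']
    intro v hv
    have h1 : A *ᵥ v.ofLp = 0 := congrArg WithLp.ofLp hv
    have h2 : v.ofLp = 0 := by
      obtain ⟨C, hC⟩ := hA.isUnit.exists_left_inv
      rw [← one_mulVec v.ofLp, ← hC, ← mulVec_mulVec, h1, mulVec_zero]
    exact congrArg (WithLp.toLp 2) h2
  rw [supportProj, supportProj, Submodule.starProjection_le_starProjection_iff, hker,
    Submodule.bot_orthogonal_eq_top]
  exact le_top

lemma logMajorizedBy_spectral_renyi (hα0 : 0 < α) (hα1 : α < 1) (hp : 0 < p) (hq : 0 < q)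
    (hpq : p / q ≤ α) {A B : Matrix (Fin n) (Fin n) ℂ} (hA : 0 ≤ A) (hB : 0 ≤ B)
    (h : supportProj B ≤ supportProj A) :
    LogMajorizedBy (quasiSpectralMean α p A B) (renyiMean α q A B) := by
  obtain ⟨D, hD, hS, hR⟩ := exists_posDef_means_eq hα0 hα1 hp hq hA hB h
  have hD0 := hD.posSemidef.nonneg
  rw [hS, hR]
  refine logMajorizedBy_of_norm_compound_le (quasiSpectralMean_nonneg _ _ _ _)
    (renyiMean_nonneg _ _ _ _) (fun k => ?_) ?_
  · rw [compound_quasiSpectralMean k α p hD0 hB, compound_renyiMean k α q hD0 hB]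
    exact norm_spectralMean_le_norm_renyiMean hα0 hα1 hp hq ((div_le_iff₀ hq).mp hpq)
      (compound_posDef hD) (compound_nonneg hB)
  · rw [norm_det_quasiSpectralMean hp hD hB, norm_det_renyiMean hq hD hB]

lemma logMajorizedBy_renyi_spectral (hα0 : 0 < α) (hα1 : α ≤ 1 / 2) (hp : 0 < p) (hq : 0 < q)
    (hpq : q ≤ p) {A B : Matrix (Fin n) (Fin n) ℂ} (hA : 0 ≤ A) (hB : 0 ≤ B)
    (h : supportProj B ≤ supportProj A) :
    LogMajorizedBy (renyiMean α q A B) (quasiSpectralMean α p A B) := by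
  have hα1' : α < 1 := by linarith
  obtain ⟨D, hD, hS, hR⟩ := exists_posDef_means_eq hα0 hα1' hp hq hA hB h
  have hD0 := hD.posSemidef.nonneg
  rw [hS, hR]
  refine logMajorizedBy_of_norm_compound_le (renyiMean_nonneg _ _ _ _)
    (quasiSpectralMean_nonneg _ _ _ _) (fun k => ?_) ?_
  · rw [compound_quasiSpectralMean k α p hD0 hB, compound_renyiMean k α q hD0 hB]
    exact norm_renyiMean_le_of_forall_posDef hα0 hα1' hp hq (compound_posDef hD)
      (fun B' hB' => norm_renyiMean_le_norm_spectralMean_of_posDef hα0 hα1 hp hq hpq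
        (compound_posDef hD) hB') (compound_nonneg hB)
  · rw [norm_det_quasiSpectralMean hp hD hB, norm_det_renyiMean hq hD hB]

end QuasiMean

/-! ### Rank-one tests and the necessity of the parameter conditions. -/

namespace Matrix

/-- The spectrum lies in `{0, m}`, where `x^r = m^(r-1) x`. -/
lemma rpow_eq_smul_of_mul_self_eq_smul {n : Type*} [Fintype n] [DecidableEq n] {W : Matrix n n ℂ}
    (hW : 0 ≤ W) {m : ℝ} (hm : 0 < m) (h : W * W = m • W) {r : ℝ} (hr : r ≠ 0) :
    W ^ r = m ^ (r - 1) • W := by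
  have hsa := hW.isSelfAdjoint
  have hcont := W.continuousOn_real_spectrum
  have h1 : cfc (fun x : ℝ => x * x) W = cfc (fun x : ℝ => m * x) W := by
    rw [cfc_mul _ _ W (hcont _) (hcont _), cfc_const_mul m _ W (hcont _), cfc_id' ℝ W hsa, h]
  have h2 := (cfc_eq_cfc_iff_eqOn (R := ℝ) (ha := hsa) (hcont _) (hcont _)).mp h1
  rw [CFC.rpow_eq_cfc_real hW]
  nth_rewrite 2 [← cfc_id' ℝ W hsa]
  rw [← cfc_smul _ _ W (hcont _)]
  refine cfc_congr fun x hx => ?_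
  have hx' : x * x = m * x := h2 hx
  rcases eq_or_ne x 0 with rfl | h0
  · simp [Real.zero_rpow hr]
  · obtain rfl : x = m := mul_right_cancel₀ h0 hx'
    rw [smul_eq_mul, Real.rpow_sub_one h0, div_mul_cancel₀ _ h0]

end Matrix

namespace QuasiMean

open Matrix Filter Topology

section RankOne

variable {n : ℕ} {α p q : ℝ} {A E : Matrix (Fin n) (Fin n) ℂ} {m : ℝ → ℝ}

lemma norm_rpow_conj_of_compression (hA : A.PosDef) (hE : 0 ≤ E) (hEE : E * E = E) (hE1 : ‖E‖ = 1)
    (hm : ∀ r, 0 < m r) (hmE : ∀ r, E * A ^ r * E = m r • E) (x : ℝ) :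
    ‖A ^ x * E * A ^ x‖ = m (2 * x) := by
  have hAx : IsSelfAdjoint (A ^ x) := (Matrix.rpow_nonneg A x).isSelfAdjoint
  have h1 : A ^ x * E * A ^ x = (A ^ x * E) * star (A ^ x * E) := by
    rw [star_mul, hE.isSelfAdjoint.star_eq, hAx.star_eq, mul_assoc (A ^ x) E (E * A ^ x),
      ← mul_assoc E E, hEE, mul_assoc]
  have h2 : star (A ^ x * E) * (A ^ x * E) = m (2 * x) • E := by
    rw [star_mul, hE.isSelfAdjoint.star_eq, hAx.star_eq, ← hmE, two_mul, hA.rpow_add]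
    simp only [mul_assoc]
  rw [h1, CStarRing.norm_self_mul_star, ← CStarRing.norm_star_mul_self, h2, norm_smul, hE1, mul_one,
    Real.norm_of_nonneg (hm _).le]

lemma norm_renyiMean_of_compression (hα0 : 0 < α) (hq : 0 < q) (hA : A.PosDef) (hE : 0 ≤ E)
    (hEE : E * E = E) (hE1 : ‖E‖ = 1) (hm : ∀ r, 0 < m r) (hmE : ∀ r, E * A ^ r * E = m r • E) :
    ‖renyiMean α q A E‖ = m ((1 - α) * q) ^ (1 / q) := by
  have hEr : E ^ (α * q) = E := by
    simpa using rpow_eq_smul_of_mul_self_eq_smul hE one_pos (by simpa using hEE)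
      (r := α * q) (by positivity)
  rw [norm_renyiMean hq, renyiCore, hEr, norm_rpow_conj_of_compression hA hE hEE hE1 hm hmE]
  congr 2
  ring

lemma norm_quasiSpectralMean_of_compression (hα0 : 0 < α) (hp : 0 < p) (hA : A.PosDef) (hE : 0 ≤ E)
    (hEE : E * E = E) (hE1 : ‖E‖ = 1) (hm : ∀ r, 0 < m r) (hmE : ∀ r, E * A ^ r * E = m r • E) :
    ‖quasiSpectralMean α p A E‖ = (m p ^ (α - 1) * m (2 * p * (1 - α))) ^ (1 / p) := by
  have hEr : E ^ p = E := by
    simpa using rpow_eq_smul_of_mul_self_eq_smul hE one_pos (by simpa using hEE)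
      (r := p) (by positivity)
  set W := A ^ (p / 2) * E * A ^ (p / 2) with hW
  -- `W` is a multiple of a projection, so its power `α` is again a multiple of `W`.
  have hWW : W * W = m p • W := by
    have h1 : W * W = A ^ (p / 2) * (E * (A ^ (p / 2) * A ^ (p / 2)) * E) * A ^ (p / 2) := by
      simp only [hW, mul_assoc]
    rw [h1, ← hA.rpow_add, add_halves, hmE, mul_smul_comm, smul_mul_assoc]
  have hcore : spectralCore α p A E = m p ^ (α - 1) • (A ^ (p * (1 - α)) * E * A ^ (p * (1 - α))) := by
    rw [spectralCore, hEr, rpow_eq_smul_of_mul_self_eq_smul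
      (Matrix.rpow_conj_nonneg A hE (p / 2)) (hm p) hWW hα0.ne', mul_smul_comm, smul_mul_assoc,
      hA.rpow_conj_conj, show p * (1 / 2 - α) + p / 2 = p * (1 - α) by ring]
  rw [norm_quasiSpectralMean hp hA, hcore, norm_smul,
    Real.norm_of_nonneg (Real.rpow_nonneg (hm p).le _),
    norm_rpow_conj_of_compression hA hE hEE hE1 hm hmE, ← mul_assoc]

end RankOne

lemma exists_diagonal_compression {s t : ℝ} (hs0 : 0 < s) (hs1 : s < 1) (ht : 0 < t) :
    ∃ A E : Matrix (Fin 2) (Fin 2) ℂ, A.PosDef ∧ 0 ≤ E ∧ E * E = E ∧ ‖E‖ = 1 ∧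
      ∀ r : ℝ, E * A ^ r * E = (s + (1 - s) * t ^ r) • E := by
  -- `E` projects onto this unit vector, whose quadratic form against `diag(1, t^r)` is `s + (1-s)
  -- t^r`.
  set v : Fin 2 → ℂ := ![(√s : ℂ), (√(1 - s) : ℂ)] with hv
  set d : Fin 2 → ℝ := ![1, t] with hd
  have hd0 : ∀ i, 0 < d i := by
    intro i
    fin_cases i <;> simp [hd, ht]
  have h1 : (√s : ℂ) * √s = s := by
    rw [← Complex.ofReal_mul, Real.mul_self_sqrt hs0.le]
  have h2 : (√(1 - s) : ℂ) * √(1 - s) = 1 - s := by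
    rw [← Complex.ofReal_mul, Real.mul_self_sqrt (by linarith)]
    push_cast
    rfl
  have hE : (0 : Matrix (Fin 2) (Fin 2) ℂ) ≤ vecMulVec v (star v) :=
    nonneg_iff_posSemidef.mpr (posSemidef_vecMulVec_self_star v)
  have hcomp (c : Fin 2 → ℝ) : vecMulVec v (star v) * diagonal (fun i => (c i : ℂ)) *
      vecMulVec v (star v) = (s * c 0 + (1 - s) * c 1) • vecMulVec v (star v) := by
    have hdot : (star v ᵥ* diagonal (fun i => (c i : ℂ))) ⬝ᵥ v = ((s * c 0 + (1 - s) * c 1 : ℝ) : ℂ) := by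
      simp only [dotProduct, vecMul_diagonal, Fin.sum_univ_two, hv, Pi.star_apply, cons_val_zero,
        cons_val_one, RCLike.star_def, Complex.conj_ofReal]
      push_cast
      linear_combination (c 0 : ℂ) * h1 + (c 1 : ℂ) * h2
    rw [vecMulVec_mul, vecMulVec_mul_vecMulVec, hdot]
    ext i j
    simp
  have hEE : vecMulVec v (star v) * vecMulVec v (star v) = vecMulVec v (star v) := by
    have := hcomp 1
    simpa using this
  refine ⟨diagonal fun i => (d i : ℂ), vecMulVec v (star v), ?_, hE, hEE, ?_, fun r => ?_⟩
  · rw [posDef_diagonal_iff]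
    intro i
    exact_mod_cast hd0 i
  · have hne : ‖vecMulVec v (star v)‖ ≠ 0 := by
      rw [norm_ne_zero_iff]
      intro h0
      have h00 := congrFun (congrFun h0 0) 0
      simp only [vecMulVec_apply, hv, cons_val_zero, Pi.star_apply, RCLike.star_def,
        Complex.conj_ofReal, h1, Matrix.zero_apply] at h00
      exact hs0.ne' (by exact_mod_cast h00)
    have hsq : ‖vecMulVec v (star v)‖ * ‖vecMulVec v (star v)‖ = ‖vecMulVec v (star v)‖ := by
      rw [← CStarRing.norm_star_mul_self, hE.isSelfAdjoint.star_eq, hEE]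
    exact mul_left_cancel₀ hne (by rw [hsq, mul_one])
  · rw [diagonal_rpow (fun i => (hd0 i).le), hcomp fun i => d i ^ r]
    simp [hd]

variable {α p q : ℝ}

lemma compression_le_of_quasiSpectralMean_le (hα0 : 0 < α) (hα1 : α < 1) (hp : 0 < p) (hq : 0 < q)
    (h : ∀ A B : Matrix (Fin 2) (Fin 2) ℂ, A.PosDef → B.PosDef →
      LogMajorizedBy (quasiSpectralMean α p A B) (renyiMean α q A B))
    {s t : ℝ} (hs0 : 0 < s) (hs1 : s < 1) (ht : 0 < t) :
    ((s + (1 - s) * t ^ p) ^ (α - 1) * (s + (1 - s) * t ^ (2 * p * (1 - α)))) ^ (1 / p) ≤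
      (s + (1 - s) * t ^ ((1 - α) * q)) ^ (1 / q) := by
  obtain ⟨A, E, hA, hE, hEE, hE1, hm⟩ := exists_diagonal_compression hs0 hs1 ht
  have hpos (r : ℝ) : 0 < s + (1 - s) * t ^ r := by
    have := Real.rpow_pos_of_pos ht r
    nlinarith
  rw [← norm_quasiSpectralMean_of_compression hα0 hp hA hE hEE hE1 hpos hm,
    ← norm_renyiMean_of_compression hα0 hq hA hE hEE hE1 hpos hm]
  exact norm_quasiSpectralMean_le_of_forall_posDef hα0 hα1 hp hq hA
    (fun B hB => (h A B hA hB).norm_le two_pos) hE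

lemma le_compression_of_renyiMean_le (hα0 : 0 < α) (hα1 : α < 1) (hp : 0 < p) (hq : 0 < q)
    (h : ∀ A B : Matrix (Fin 2) (Fin 2) ℂ, A.PosDef → B.PosDef →
      LogMajorizedBy (renyiMean α q A B) (quasiSpectralMean α p A B))
    {s t : ℝ} (hs0 : 0 < s) (hs1 : s < 1) (ht : 0 < t) :
    (s + (1 - s) * t ^ ((1 - α) * q)) ^ (1 / q) ≤
      ((s + (1 - s) * t ^ p) ^ (α - 1) * (s + (1 - s) * t ^ (2 * p * (1 - α)))) ^ (1 / p) := by
  obtain ⟨A, E, hA, hE, hEE, hE1, hm⟩ := exists_diagonal_compression hs0 hs1 ht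
  have hpos (r : ℝ) : 0 < s + (1 - s) * t ^ r := by
    have := Real.rpow_pos_of_pos ht r
    nlinarith
  rw [← norm_quasiSpectralMean_of_compression hα0 hp hA hE hEE hE1 hpos hm,
    ← norm_renyiMean_of_compression hα0 hq hA hE hEE hE1 hpos hm]
  exact norm_renyiMean_le_of_forall_posDef hα0 hα1 hp hq hA
    (fun B hB => (h A B hA hB).norm_le two_pos) hE

lemma div_le_of_logMajorizedBy (hα0 : 0 < α) (hα1 : α < 1) (hp : 0 < p) (hq : 0 < q)
    (h : ∀ A B : Matrix (Fin 2) (Fin 2) ℂ, A.PosDef → B.PosDef →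
      LogMajorizedBy (quasiSpectralMean α p A B) (renyiMean α q A B)) : p / q ≤ α := by
  have hα : 0 < 1 - α := by linarith
  have hlim {r : ℝ} (hr : 0 < r) : Tendsto (fun t : ℝ => 1 / 2 + (1 - 1 / 2) * t ^ r)
      (𝓝[>] 0) (𝓝 (1 / 2 : ℝ)) := by
    refine (Continuous.tendsto' ?_ _ _ ?_).mono_left nhdsWithin_le_nhds
    · exact continuous_const.add (continuous_const.mul
        (continuous_id.rpow_const fun _ => Or.inr hr.le))
    · simp [Real.zero_rpow hr.ne']
  have hL := (((hlim hp).rpow_const (p := α - 1) (Or.inl (by norm_num))).mul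
    (hlim (r := 2 * p * (1 - α)) (by positivity))).rpow_const (p := 1 / p) (Or.inr (by positivity))
  have hR := (hlim (r := (1 - α) * q) (by positivity)).rpow_const (p := 1 / q)
    (Or.inr (by positivity))
  -- As `t → 0` every `m(r)` with `r > 0` tends to `s = 1/2`, leaving `α/p ≥ 1/q`.
  have hle : ((1 / 2 : ℝ) ^ (α - 1) * (1 / 2)) ^ (1 / p) ≤ (1 / 2 : ℝ) ^ (1 / q) := by
    refine le_of_tendsto_of_tendsto hL hR ?_
    filter_upwards [self_mem_nhdsWithin] with t ht
    exact compression_le_of_quasiSpectralMean_le hα0 hα1 hp hq h (by norm_num) (by norm_num) ht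
  rw [← Real.rpow_add_one (by norm_num), sub_add_cancel, ← Real.rpow_mul (by norm_num),
    Real.rpow_le_rpow_left_iff_of_base_lt_one (by norm_num) (by norm_num)] at hle
  rw [div_le_iff₀ hq]
  rw [mul_one_div, div_le_div_iff₀ hq hp] at hle
  linarith

lemma le_of_eventually_mul_rpow_le {a b c C : ℝ} (hc : 0 < c)
    (h : ∀ᶠ t in 𝓝[>] (0 : ℝ), c * t ^ a ≤ C * t ^ b) : b ≤ a := by
  by_contra! hab
  have hlim : Tendsto (fun t : ℝ => C * t ^ (b - a)) (𝓝[>] 0) (𝓝 0) := by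
    refine (Continuous.tendsto' ?_ _ _ ?_).mono_left nhdsWithin_le_nhds
    · exact continuous_const.mul (continuous_id.rpow_const fun _ => Or.inr (by linarith))
    · rw [Real.zero_rpow (by linarith), mul_zero]
  refine absurd hc (not_lt.mpr (ge_of_tendsto hlim ?_))
  filter_upwards [h, self_mem_nhdsWithin] with t ht ht0
  have ht0 : 0 < t := ht0
  have hta := Real.rpow_pos_of_pos ht0 a
  rw [Real.rpow_sub ht0, ← mul_div_assoc, le_div_iff₀ hta]
  exact ht

lemma eventually_rpow_le_half {u : ℝ} (hu : 0 < u) :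
    ∀ᶠ t in 𝓝[>] (0 : ℝ), 0 < t ∧ t < 1 ∧ t ^ u ≤ 1 / 2 := by
  have hlim : Tendsto (fun t : ℝ => t ^ u) (𝓝[>] 0) (𝓝 0) := by
    refine (Continuous.tendsto' ?_ _ _ ?_).mono_left nhdsWithin_le_nhds
    · exact continuous_id.rpow_const fun _ => Or.inr hu.le
    · exact Real.zero_rpow hu.ne'
  filter_upwards [self_mem_nhdsWithin, Ioo_mem_nhdsGT one_pos,
    hlim.eventually_le_const (by norm_num : (0 : ℝ) < 1 / 2)] with t h1 h2 h3
  exact ⟨h1, h2.2, h3⟩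

section

variable {t u : ℝ}

lemma rpow_le_convexComb (ht : 0 < t) (hu : t ^ u ≤ 1 / 2) (r : ℝ) :
    t ^ u ≤ t ^ u + (1 - t ^ u) * t ^ r := by
  have := Real.rpow_pos_of_pos ht r
  nlinarith

lemma half_mul_rpow_le_convexComb (ht : 0 < t) (hu : t ^ u ≤ 1 / 2) (r : ℝ) :
    1 / 2 * t ^ r ≤ t ^ u + (1 - t ^ u) * t ^ r := by
  have := Real.rpow_pos_of_pos ht r
  have := Real.rpow_pos_of_pos ht u
  nlinarith

lemma convexComb_le_two_mul_rpow (ht : 0 < t) (ht1 : t < 1) {r : ℝ} (hr : r ≤ u) :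
    t ^ u + (1 - t ^ u) * t ^ r ≤ 2 * t ^ r := by
  have h1 := Real.rpow_le_rpow_of_exponent_ge ht ht1.le hr
  have := Real.rpow_pos_of_pos ht r
  have := Real.rpow_pos_of_pos ht u
  nlinarith

end

lemma le_half_of_logMajorizedBy (hα0 : 0 < α) (hα1 : α < 1) (hp : 0 < p) (hq : 0 < q)
    (h : ∀ A B : Matrix (Fin 2) (Fin 2) ℂ, A.PosDef → B.PosDef →
      LogMajorizedBy (renyiMean α q A B) (quasiSpectralMean α p A B)) : α ≤ 1 / 2 := by
  by_contra! hα
  -- For `α > 1/2` this is the midpoint of `2p(1-α)` and `p`. With `s = t^u`, `m(p)` is then of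
  -- order `t^u` and `m(2p(1-α))` of order `t^(2p(1-α))`, so the spectral side decays like
  -- `t^((1-α)(1/2+α))`, faster than the lower bound `t^(1-α)` for the Rényi side.
  set u := p * (3 / 2 - α) with hu
  have hu0 : 0 < u := mul_pos hp (by linarith)
  have key : ∀ᶠ t in 𝓝[>] (0 : ℝ), (1 / 2) ^ (1 / q) * t ^ (1 - α) ≤
      2 ^ (1 / p) * t ^ ((u * (α - 1) + 2 * p * (1 - α)) / p) := by
    filter_upwards [eventually_rpow_le_half hu0] with t ⟨ht0, ht1, htu⟩
    have htu0 := Real.rpow_pos_of_pos ht0 u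
    have h1 := le_compression_of_renyiMean_le hα0 hα1 hp hq h htu0 (by linarith) ht0
    have h2 : (1 / 2 * t ^ ((1 - α) * q)) ^ (1 / q) ≤
        (t ^ u + (1 - t ^ u) * t ^ ((1 - α) * q)) ^ (1 / q) :=
      Real.rpow_le_rpow (by positivity) (half_mul_rpow_le_convexComb ht0 htu _) (by positivity)
    have h3 : (t ^ u + (1 - t ^ u) * t ^ p) ^ (α - 1) ≤ (t ^ u) ^ (α - 1) :=
      Real.rpow_le_rpow_of_nonpos htu0 (rpow_le_convexComb ht0 htu p) (by linarith)
    have h4 : t ^ u + (1 - t ^ u) * t ^ (2 * p * (1 - α)) ≤ 2 * t ^ (2 * p * (1 - α)) :=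
      convexComb_le_two_mul_rpow ht0 ht1 (by nlinarith)
    have h5 : 0 < t ^ u + (1 - t ^ u) * t ^ (2 * p * (1 - α)) :=
      htu0.trans_le (rpow_le_convexComb ht0 htu _)
    have h6 : 0 < t ^ u + (1 - t ^ u) * t ^ p := htu0.trans_le (rpow_le_convexComb ht0 htu _)
    have h7 := Real.rpow_le_rpow (by positivity) (mul_le_mul h3 h4 h5.le (by positivity))
      (by positivity : 0 ≤ 1 / p)
    refine le_trans (le_of_eq ?_) ((h2.trans (h1.trans h7)).trans (le_of_eq ?_))
    · rw [Real.mul_rpow (by norm_num) (by positivity), ← Real.rpow_mul ht0.le]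
      congr 2
      field_simp
    · rw [mul_left_comm, ← Real.rpow_mul ht0.le, ← Real.rpow_add ht0,
        Real.mul_rpow (by norm_num) (by positivity), ← Real.rpow_mul ht0.le, mul_one_div]
  have hle := le_of_eventually_mul_rpow_le (by positivity) key
  rw [div_le_iff₀ hp, hu] at hle
  nlinarith [mul_pos hp (mul_pos (sub_pos.mpr hα1) (sub_pos.mpr hα))]

lemma half_le_div_of_logMajorizedBy (hα0 : 0 < α) (hα1 : α < 1) (hp : 0 < p) (hq : 0 < q)
    (h : ∀ A B : Matrix (Fin 2) (Fin 2) ℂ, A.PosDef → B.PosDef →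
      LogMajorizedBy (renyiMean α q A B) (quasiSpectralMean α p A B)) : 1 / 2 ≤ p / q := by
  have hα : 0 < 1 - α := by linarith
  -- With `s = t^u` the Rényi side is at least `t^(u/q)`, while the spectral side is `O(t^(1-α))`.
  set u := 2 * p * (1 - α) with hu
  have hu0 : 0 < u := by positivity
  have key : ∀ᶠ t in 𝓝[>] (0 : ℝ), 1 * t ^ (u * (1 / q)) ≤
      ((1 / 2) ^ (α - 1) * 2) ^ (1 / p) * t ^ ((p * (α - 1) + u) / p) := by
    filter_upwards [eventually_rpow_le_half hu0] with t ⟨ht0, ht1, htu⟩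
    have htu0 := Real.rpow_pos_of_pos ht0 u
    have htp0 := Real.rpow_pos_of_pos ht0 p
    have h1 := le_compression_of_renyiMean_le hα0 hα1 hp hq h htu0 (by linarith) ht0
    have h2 : (t ^ u) ^ (1 / q) ≤
        (t ^ u + (1 - t ^ u) * t ^ ((1 - α) * q)) ^ (1 / q) :=
      Real.rpow_le_rpow htu0.le (rpow_le_convexComb ht0 htu _) (by positivity)
    have h3 : (t ^ u + (1 - t ^ u) * t ^ p) ^ (α - 1) ≤ (1 / 2 * t ^ p) ^ (α - 1) :=
      Real.rpow_le_rpow_of_nonpos (by positivity) (half_mul_rpow_le_convexComb ht0 htu p)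
        (by linarith)
    have h4 : t ^ u + (1 - t ^ u) * t ^ u ≤ 2 * t ^ u :=
      convexComb_le_two_mul_rpow ht0 ht1 le_rfl
    have h5 : 0 < t ^ u + (1 - t ^ u) * t ^ u := htu0.trans_le (rpow_le_convexComb ht0 htu _)
    have h6 : 0 < t ^ u + (1 - t ^ u) * t ^ p := htu0.trans_le (rpow_le_convexComb ht0 htu _)
    have h7 := Real.rpow_le_rpow (by positivity) (mul_le_mul h3 h4 h5.le (by positivity))
      (by positivity : 0 ≤ 1 / p)
    refine le_trans (le_of_eq ?_) ((h2.trans (h1.trans h7)).trans (le_of_eq ?_))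
    · rw [one_mul, ← Real.rpow_mul ht0.le]
    · rw [Real.mul_rpow (by norm_num) htp0.le, mul_mul_mul_comm, ← Real.rpow_mul ht0.le,
        ← Real.rpow_add ht0, Real.mul_rpow (by positivity) (by positivity),
        ← Real.rpow_mul ht0.le, mul_one_div]
  have hle := le_of_eventually_mul_rpow_le one_pos key
  rw [show (p * (α - 1) + u) / p = 1 - α by rw [hu]; field_simp; ring,
    show u * (1 / q) = (1 - α) * (2 * (p / q)) by rw [hu]; ring] at hle
  have := le_of_mul_le_mul_left ((mul_one (1 - α)).le.trans hle) hα
  linarith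

end QuasiMean

end

theorem theorem3p6 (α p q : ℝ) (hα₀ : 0 < α) (hα₁ : α < 1) (hp : 0 < p) (hq : 0 < q) :
    List.TFAE [
      ∀ (n : ℕ) (A B : Matrix (Fin n) (Fin n) ℂ), A.PosSemidef → B.PosSemidef →
        QuasiMean.supportProj B ≤ QuasiMean.supportProj A →
        QuasiMean.LogMajorizedBy (QuasiMean.quasiSpectralMean α p A B)
          (QuasiMean.renyiMean α q A B),
      ∀ A B : Matrix (Fin 2) (Fin 2) ℂ, A.PosDef → B.PosDef →
        QuasiMean.LogMajorizedBy (QuasiMean.quasiSpectralMean α p A B)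
          (QuasiMean.renyiMean α q A B),
      p / q ≤ α] ∧
    (α ≤ 1 / 2 → q ≤ p →
      ∀ (n : ℕ) (A B : Matrix (Fin n) (Fin n) ℂ), A.PosSemidef → B.PosSemidef →
        QuasiMean.supportProj B ≤ QuasiMean.supportProj A →
        QuasiMean.LogMajorizedBy (QuasiMean.renyiMean α q A B)
          (QuasiMean.quasiSpectralMean α p A B)) ∧
    ((∀ A B : Matrix (Fin 2) (Fin 2) ℂ, A.PosDef → B.PosDef →
        QuasiMean.LogMajorizedBy (QuasiMean.renyiMean α q A B)
          (QuasiMean.quasiSpectralMean α p A B)) →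
      α ≤ 1 / 2 ∧ 1 / 2 ≤ p / q) := by
  refine ⟨?_, ?_, ?_⟩
  · tfae_have 1 → 2 := fun h A B hA hB => h 2 A B hA.posSemidef hB.posSemidef
      (QuasiMean.supportProj_le_of_posDef hA B)
    tfae_have 2 → 3 := QuasiMean.div_le_of_logMajorizedBy hα₀ hα₁ hp hq
    tfae_have 3 → 1 := fun h n A B hA hB hAB =>
      QuasiMean.logMajorizedBy_spectral_renyi hα₀ hα₁ hp hq h hA.nonneg hB.nonneg hAB
    tfae_finish
  · exact fun hα hpq n A B hA hB hAB =>
      QuasiMean.logMajorizedBy_renyi_spectral hα₀ hα hp hq hpq hA.nonneg hB.nonneg hAB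
  · exact fun h => ⟨QuasiMean.le_half_of_logMajorizedBy hα₀ hα₁ hp hq h,
      QuasiMean.half_le_div_of_logMajorizedBy hα₀ hα₁ hp hq h⟩
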